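/- Let $p\ge 1$ and let $L\subset\mathbb C$ be a simple closed contour, positively oriented, with a regular parametrization of class $C^p$ (in particular, any $C^\infty$ contour). Let $D^+$ be its inner domain, and let $G\subseteq\mathbb C$ be a domain (a connected set, open or closed) with $L\cup D^+\subseteq G$. Let $a_0,\dots,a_p,f$ be complex-valued functions, and let $x$ be analytic in $G$ (that is, in a neighbourhood of each point of $G$). For $t\in L$ and $k\ge1$ the Cauchy–Hadamard integral is $$\int_L\frac{x(\tau)\,d\tau}{(\tau-t)^k}=\lim_{v\to0+}\Big[\int_{\tau\in L,\ |\tau-t|>v}\frac{x(\tau)\,d\tau}{(\tau-t)^k}+\frac{\xi(v)}{v^{k-1}}\Big],$$ where $\xi$ is a polynomial of degree less than $k-1$ (so $\xi=0$ for $k=1$, the Cauchy principal value) for which the limit exists; the value does not depend on the choice of $\xi$. Consider the composite hypersingular integral equation $$\sum_{k=1}^{p}\frac{a_k(t)}{\pi i}\int_L\frac{x(\tau)\,d\tau}{(\tau-t)^k}+a_0(t)x(t)=f(t),\qquad(3.9)$$ a solution of which is required to be such that all the integrals in it exist, and the differential equation $$\sum_{k=1}^{p}\frac{a_k(t)}{(k-1)!}\,x^{(k-1)}(t)+a_0(t)x(t)=f(t).\qquad(3.10)$$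 Then $x$ solves (3.9) for all $t\in L$ if and only if $x$ solves (3.10) for all $t\in L$. If moreover $a_0,\dots,a_p$ and $f$ are analytic in $G$, then $x$ solves (3.9) for all $t\in L$ if and only if $x$ solves (3.10) for all $t\in G$. -/

import Mathlib

open Set Filter Topology MeasureTheory

noncomputable section

namespace Hypersingular

/-- The inner domain `D⁺` of a closed curve: the points off the curve whose connected
component in the complement of the curve is bounded. -/
def innerDomain (γ : ℝ → ℂ) : Set ℂ :=
  {z | z ∉ range γ ∧ Bornology.IsBounded (connectedComponentIn (range γ)ᶜ z)}

/-- The winding number of the closed curve `γ` (of period `1`) about `z`. -/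
def windingNumber (γ : ℝ → ℂ) (z : ℂ) : ℂ :=
  (2 * (Real.pi : ℂ) * Complex.I)⁻¹ * ∫ s in (0 : ℝ)..1, deriv γ s / (γ s - z)

/-- `γ` is a regular parametrization, of period `1`, of a simple closed contour of class `C^n`
that is positively oriented (it winds once counterclockwise around its inner domain). -/
structure IsSmoothContour (n : ℕ) (γ : ℝ → ℂ) : Prop where
  contDiff : ContDiff ℝ n γ
  periodic : Function.Periodic γ 1
  deriv_ne_zero : ∀ s, deriv γ s ≠ 0
  injOn : InjOn γ (Ico 0 1)
  positive : ∀ z ∈ innerDomain γ, windingNumber γ z = 1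

/-- The parameters of the part of the contour at distance more than `v` from `t`. -/
def cutParam (γ : ℝ → ℂ) (t : ℂ) (v : ℝ) : Set ℝ :=
  {s | s ∈ Ico (0 : ℝ) 1 ∧ v < ‖γ s - t‖}

/-- The pulled back integrand of `∫_L φ(τ) dτ / (τ - t)^k`. -/
def kernel (γ : ℝ → ℂ) (φ : ℂ → ℂ) (k : ℕ) (t : ℂ) (s : ℝ) : ℂ :=
  φ (γ s) / (γ s - t) ^ k * deriv γ s

/-- The Cauchy–Hadamard integral `∫_L φ(τ) dτ / (τ - t)^k` (`k ≥ 1`) exists and equals `I`: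
`I = lim_{v → 0+} [∫_{τ ∈ L, |τ - t| > v} φ(τ) dτ / (τ - t)^k + ξ(v) / v^(k-1)]`,
where the compensating function `ξ` is a polynomial of degree less than `k - 1`. The bound on the
degree says that only negative powers of `v` are discarded, so that `I` is unique; a term of
`ξ` of order `v^(k-1)` would shift the limit. For `k = 1` one has `ξ = 0`, and this is the
Cauchy principal value. -/
def HasHypersingularIntegral (γ : ℝ → ℂ) (φ : ℂ → ℂ) (k : ℕ) (t I : ℂ) : Prop :=
  (∀ᶠ v in 𝓝[>] (0 : ℝ), IntegrableOn (kernel γ φ k t) (cutParam γ t v)) ∧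
  ∃ ξ ∈ Polynomial.degreeLT ℂ (k - 1),
    Tendsto (fun v : ℝ => (∫ s in cutParam γ t v, kernel γ φ k t s)
      + ξ.eval (v : ℂ) / (v : ℂ) ^ (k - 1)) (𝓝[>] 0) (𝓝 I)

/-- `x` solves, at every point `t` of the contour, the composite hypersingular equation
`∑_{k=1}^p a_k(t)/(π i) ∫_L x(τ) dτ / (τ - t)^k + a_0(t) x(t) = f(t)`;
in particular the integrals exist. -/
def SolvesComposite (γ : ℝ → ℂ) (p : ℕ) (a : ℕ → ℂ → ℂ) (f x : ℂ → ℂ) : Prop :=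
  ∀ t ∈ range γ, ∃ I : ℕ → ℂ,
    (∀ k ∈ Finset.Icc 1 p, HasHypersingularIntegral γ x k t (I k)) ∧
    ∑ k ∈ Finset.Icc 1 p, a k t / ((Real.pi : ℂ) * Complex.I) * I k + a 0 t * x t = f t

/-- `x` satisfies, at every point `t` of `S`, the differential equation
`∑_{k=1}^p a_k(t)/(k-1)! x^(k-1)(t) + a_0(t) x(t) = f(t)`. -/
def SolvesODE (S : Set ℂ) (p : ℕ) (a : ℕ → ℂ → ℂ) (f x : ℂ → ℂ) : Prop :=
  ∀ t ∈ S, ∑ k ∈ Finset.Icc 1 p,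
    a k t / (Nat.factorial (k - 1) : ℂ) * iteratedDeriv (k - 1) x t + a 0 t * x t = f t

end Hypersingular

end

/-! For `x` holomorphic near the contour and its inner domain, the Cauchy–Hadamard integral of order
`k` at `t ∈ L` exists and equals `π i x^(k-1)(t) / (k-1)!`. By `HasHypersingularIntegral.unique` no
other value is possible, so the two equations agree term by term at each point of the contour.

The value comes from induction on `k`, writing `x(τ) = x(t) + (τ - t) y(τ)` with `y = dslope x t`,
again holomorphic, whose Taylor coefficients at `t` are those of `x` shifted by one. The order drops
by one for `y`, and what splits off is `x(t)` times the integral of the constant `1`. At the bottom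
`∫ y dτ` is an ordinary integral, zero by Cauchy's theorem (`integral_comp_mul_deriv_eq_zero`, by
Dixon's argument, which needs only that the winding integral vanishes outside the inner domain).

For the constant `1` and `k = 1` the principal value is `π i`: the winding integrals at nearby
points on the two sides of the arc have limits that differ by `2π i`, both limits lie in `{0, 2π
i}`, and the principal value is their mean. For `k = n + 1 ≥ 2` there is a single-valued primitive,
and only its values at the two ends of the cut arc matter. These ends have signed chord lengths `v`
and `-v`; an expansion in signed chord length (`exists_angular_expansion`) shows that the
contributions of order `v^0` cancel, so the finite part is `0`.

Passing from `L` to `G` is the identity theorem on a connected set. -/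

namespace Hypersingular

/-! ### Holomorphic parameter integrals. -/

/-- An integral over `[0, 1]` depending holomorphically on a parameter, with locally bounded
integrand, is holomorphic in the parameter. -/
theorem hasDerivAt_intervalIntegral_of_holomorphic {F : ℂ → ℝ → ℂ} {U : Set ℂ} (hU : IsOpen U)
    (hmeas : ∀ z ∈ U, ContinuousOn (F z) (Icc 0 1))
    (hdiff : ∀ s ∈ Icc (0 : ℝ) 1, DifferentiableOn ℂ (fun z => F z s) U)
    (hbd : ∀ z₀ ∈ U, ∃ r > 0, ∃ C, ∀ z ∈ Metric.ball z₀ r, ∀ s ∈ Icc (0 : ℝ) 1, ‖F z s‖ ≤ C)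
    {z₀ : ℂ} (hz₀ : z₀ ∈ U) :
    HasDerivAt (fun z => ∫ s in (0 : ℝ)..1, F z s)
      (∫ s in (0 : ℝ)..1, deriv (fun z => F z s) z₀) z₀ := by
  obtain ⟨r₁, hr₁, C, hC⟩ := hbd z₀ hz₀
  obtain ⟨r₂, hr₂, hball⟩ := Metric.isOpen_iff.1 hU z₀ hz₀
  -- With the radius halved, a circle of radius `r` about any point of `ball z₀ r` stays where `C`
  -- bounds `F`, so Cauchy's estimate dominates the derivative by `C / r`.
  set r := min r₁ r₂ / 2 with hr
  have hrpos : 0 < r := by positivity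
  have h2r₁ : 2 * r ≤ r₁ := by rw [hr]; linarith [min_le_left r₁ r₂]
  have h2r₂ : 2 * r ≤ r₂ := by rw [hr]; linarith [min_le_right r₁ r₂]
  have hsub : uIoc (0 : ℝ) 1 ⊆ Icc 0 1 := by
    rw [uIoc_of_le zero_le_one]; exact Ioc_subset_Icc_self
  have hms : ∀ z ∈ U, AEStronglyMeasurable (F z) (volume.restrict (uIoc (0 : ℝ) 1)) := fun z hz =>
    ((hmeas z hz).mono hsub).aestronglyMeasurable measurableSet_uIoc
  refine (intervalIntegral.hasDerivAt_integral_of_dominated_loc_of_deriv_le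
    (s := Metric.ball z₀ r) (bound := fun _ => C / r)
    (F' := fun z s => deriv (fun z => F z s) z) (Metric.ball_mem_nhds z₀ hrpos) ?_ ?_ ?_ ?_ ?_ ?_).2
  · filter_upwards [hU.mem_nhds hz₀] with z hz using hms z hz
  · exact ContinuousOn.intervalIntegrable (by rw [uIcc_of_le zero_le_one]; exact hmeas z₀ hz₀)
  -- Measurability of the `z`-derivative in `s`: it is a pointwise limit of difference quotients
  -- with step `1 / (n + 1)`; the shift by `N` keeps the shifted points in `U`.
  · have hu : Tendsto (fun n : ℕ => (((n : ℝ) + 1)⁻¹ : ℂ)) atTop (𝓝[≠] 0) := by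
      refine tendsto_nhdsWithin_iff.2 ⟨?_, Eventually.of_forall fun n => ?_⟩
      · have := tendsto_one_div_add_atTop_nhds_zero_nat (𝕜 := ℝ)
        have h2 := (Complex.continuous_ofReal.tendsto 0).comp this
        simpa [Function.comp_def] using h2
      · have : ((n : ℂ) + 1) ≠ 0 := by exact_mod_cast Nat.succ_ne_zero n
        simpa using this
    have hu0 : ∀ᶠ n : ℕ in atTop, z₀ + (((n : ℝ) + 1)⁻¹ : ℂ) ∈ U := by
      have h3 : Tendsto (fun n : ℕ => z₀ + (((n : ℝ) + 1)⁻¹ : ℂ)) atTop (𝓝 z₀) := by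
        simpa using (tendsto_nhdsWithin_iff.1 hu).1.const_add z₀
      exact h3.eventually (hU.mem_nhds hz₀)
    obtain ⟨N, hN⟩ := eventually_atTop.1 hu0
    refine aestronglyMeasurable_of_tendsto_ae atTop (f := fun (n : ℕ) s =>
      ((((n + N : ℕ) : ℝ) + 1)⁻¹ : ℂ)⁻¹ • (F (z₀ + ((((n + N : ℕ) : ℝ) + 1)⁻¹ : ℂ)) s - F z₀ s))
      (fun n => ?_) ?_
    · exact AEStronglyMeasurable.const_smul ((hms _ (hN _ (Nat.le_add_left N n))).sub (hms _ hz₀))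
        ((((n + N : ℕ) : ℝ) + 1)⁻¹ : ℂ)⁻¹
    · refine (ae_restrict_iff' measurableSet_uIoc).2 (Eventually.of_forall fun s hs => ?_)
      have hd := ((hdiff s (hsub hs)).differentiableAt (hU.mem_nhds hz₀)).hasDerivAt
      have h4 := (hasDerivAt_iff_tendsto_slope_zero.1 hd).comp hu
      exact (tendsto_add_atTop_iff_nat N).2 h4
  · refine Eventually.of_forall fun s hs z hz => ?_
    refine Complex.norm_deriv_le_of_forall_mem_sphere_norm_le hrpos ?_ fun w hw => ?_
    · refine DifferentiableOn.diffContOnCl ?_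
      rw [closure_ball z hrpos.ne']
      refine (hdiff s (hsub hs)).mono fun w hw => hball ?_
      rw [Metric.mem_ball] at hz ⊢
      rw [Metric.mem_closedBall] at hw
      linarith [dist_triangle w z z₀]
    · refine hC w ?_ s (hsub hs)
      rw [Metric.mem_ball] at hz ⊢
      rw [Metric.mem_sphere] at hw
      linarith [dist_triangle w z z₀]
  · simp
  · refine Eventually.of_forall fun s hs z hz => ?_
    refine ((hdiff s (hsub hs)).differentiableAt (hU.mem_nhds (hball ?_))).hasDerivAt
    rw [Metric.mem_ball] at hz ⊢
    linarith

theorem periodic_deriv {γ : ℝ → ℂ} (hγ : Function.Periodic γ 1) :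
    Function.Periodic (deriv γ) 1 := fun s => by
  have : (fun u => γ (u + 1)) = γ := funext hγ
  rw [← deriv_comp_add_const, this]

/-! ### Winding integrals and Cauchy's theorem. -/

section Cauchy

variable {γ : ℝ → ℂ}

theorem isCompact_range_of_periodic (hγ : Continuous γ) (hper : Function.Periodic γ 1) :
    IsCompact (range γ) := by
  rw [← hper.image_Icc one_pos 0]
  exact isCompact_Icc.image hγ

/-- Cauchy type integrals vanish at infinity. -/
theorem tendsto_cauchyIntegral_cocompact (hγ : Continuous γ) {ψ : ℝ → ℂ}
    (hψ : ContinuousOn ψ (Icc 0 1)) :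
    Tendsto (fun z => ∫ s in (0 : ℝ)..1, ψ s / (γ s - z)) (cocompact ℂ) (𝓝 0) := by
  obtain ⟨R, hR⟩ := (isCompact_Icc (a := (0 : ℝ)) (b := 1)).exists_bound_of_continuousOn
    hγ.continuousOn
  obtain ⟨M, hM⟩ := (isCompact_Icc (a := (0 : ℝ)) (b := 1)).exists_bound_of_continuousOn hψ
  have hM0 : 0 ≤ M := (norm_nonneg _).trans (hM 0 (by simp))
  have h1 : Tendsto (fun z : ℂ => M / (‖z‖ - R)) (cocompact ℂ) (𝓝 0) :=
    (tendsto_atTop_add_const_right _ (-R) (tendsto_norm_cocompact_atTop (E := ℂ))).const_div_atTop M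
  refine squeeze_zero_norm' ?_ h1
  filter_upwards [(tendsto_norm_cocompact_atTop (E := ℂ)).eventually_gt_atTop R] with z hz
  have : ∀ s ∈ uIoc (0 : ℝ) 1, ‖ψ s / (γ s - z)‖ ≤ M / (‖z‖ - R) := by
    intro s hs
    rw [uIoc_of_le zero_le_one] at hs
    have hs' := Ioc_subset_Icc_self hs
    rw [norm_div]
    have : ‖z‖ - R ≤ ‖γ s - z‖ := by
      rw [norm_sub_rev]
      linarith [norm_sub_norm_le z (γ s), hR s hs']
    have h0 : 0 < ‖z‖ - R := by linarith
    exact div_le_div₀ hM0 (hM s hs') h0 this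
  simpa using intervalIntegral.norm_integral_le_of_norm_le_const this

/-- Cauchy type integrals are holomorphic off the curve. -/
theorem hasDerivAt_cauchyIntegral (hγ : Continuous γ) (hper : Function.Periodic γ 1)
    {ψ : ℝ → ℂ} (hψ : ContinuousOn ψ (Icc 0 1)) {z₀ : ℂ} (hz₀ : z₀ ∉ range γ) :
    HasDerivAt (fun z => ∫ s in (0 : ℝ)..1, ψ s / (γ s - z))
      (∫ s in (0 : ℝ)..1, ψ s / (γ s - z₀) ^ 2) z₀ := by
  have hU : IsOpen (range γ)ᶜ := (isCompact_range_of_periodic hγ hper).isClosed.isOpen_compl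
  have hne : ∀ z ∉ range γ, ∀ s, γ s - z ≠ 0 := fun z hz s h =>
    hz ⟨s, sub_eq_zero.1 h⟩
  have hd : ∀ z ∉ range γ, ∀ s, HasDerivAt (fun z => ψ s / (γ s - z)) (ψ s / (γ s - z) ^ 2) z := by
    intro z hz s
    have := (((hasDerivAt_id z).const_sub (γ s)).fun_inv (hne z hz s)).const_mul (ψ s)
    refine this.congr_deriv ?_
    simp [div_eq_mul_inv]
  have key := hasDerivAt_intervalIntegral_of_holomorphic (F := fun z s => ψ s / (γ s - z)) hU
    (fun z hz => hψ.div (hγ.sub continuous_const).continuousOn fun s _ => hne z hz s)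
    (fun s _ z hz => (hd z hz s).differentiableAt.differentiableWithinAt) ?_ hz₀
  · refine key.congr_deriv ?_
    congr 1
    ext s
    exact (hd z₀ hz₀ s).deriv
  · intro z hz
    obtain ⟨r, hr, hball⟩ := Metric.isOpen_iff.1 hU z hz
    obtain ⟨M, hM⟩ := (isCompact_Icc (a := (0 : ℝ)) (b := 1)).exists_bound_of_continuousOn hψ
    have hM0 : 0 ≤ M := (norm_nonneg _).trans (hM 0 (by simp))
    refine ⟨r / 2, by positivity, M / (r / 2), fun w hw s hs => ?_⟩
    rw [norm_div]
    have h1 : r ≤ dist (γ s) z := by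
      by_contra! h
      exact hball h ⟨s, rfl⟩
    rw [Metric.mem_ball] at hw
    have h2 : r / 2 ≤ ‖γ s - w‖ := by
      rw [← dist_eq_norm]
      linarith [dist_triangle (γ s) w z]
    exact div_le_div₀ hM0 (hM s hs) (by positivity) h2

/-- A point off a ball containing the curve lies in an unbounded component. -/
theorem notMem_innerDomain_of_lt_norm {R : ℝ} (hR : ∀ s, ‖γ s‖ ≤ R) {z : ℂ} (hz : R < ‖z‖) :
    z ∉ innerDomain γ := by
  rintro ⟨-, hb⟩
  have hR0 : 0 ≤ R := (norm_nonneg _).trans (hR 0)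
  have hz0 : 0 < ‖z‖ := hR0.trans_lt hz
  -- The radial ray from `z` outwards is connected, misses the curve and is unbounded.
  have hsub : (fun r : ℝ => (r : ℂ) * z) '' Ici 1 ⊆ connectedComponentIn (range γ)ᶜ z := by
    refine IsPreconnected.subset_connectedComponentIn ?_ ⟨1, by simp, by simp⟩ ?_
    · exact isPreconnected_Ici.image _ (by fun_prop)
    · rintro _ ⟨r, hr, rfl⟩ ⟨s, hs⟩
      have h1 := hR s
      rw [hs] at h1
      simp only [norm_mul, Complex.norm_real, Real.norm_eq_abs] at h1
      have h2 : (1 : ℝ) ≤ |r| := le_trans hr (le_abs_self r)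
      nlinarith
  obtain ⟨B, hB⟩ := (hb.subset hsub).exists_norm_le
  have h3 := hB _ ⟨max 1 ((B + 1) / ‖z‖), mem_Ici.2 (le_max_left _ _), rfl⟩
  simp only [norm_mul, Complex.norm_real, Real.norm_eq_abs] at h3
  have h4 : (B + 1) / ‖z‖ ≤ |max 1 ((B + 1) / ‖z‖)| := (le_max_right _ _).trans (le_abs_self _)
  rw [div_le_iff₀ hz0] at h4
  linarith

/-- The winding integral vanishes on the unbounded components. -/
theorem integral_winding_eq_zero (hγ : ContDiff ℝ 1 γ) (hper : Function.Periodic γ 1)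
    {z : ℂ} (hz : z ∉ range γ) (hz' : z ∉ innerDomain γ) :
    ∫ s in (0 : ℝ)..1, deriv γ s / (γ s - z) = 0 := by
  have hcd : Continuous (deriv γ) := hγ.continuous_deriv le_rfl
  have hU : IsOpen (range γ)ᶜ :=
    (isCompact_range_of_periodic hγ.continuous hper).isClosed.isOpen_compl
  set N : ℂ → ℂ := fun z => ∫ s in (0 : ℝ)..1, deriv γ s / (γ s - z)
  -- The derivative integrates `d(-(γ - w)⁻¹)` around a closed curve, hence vanishes and `N` is
  -- constant on components.
  have hd : ∀ w ∉ range γ, HasDerivAt N 0 w := by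
    intro w hw
    refine (hasDerivAt_cauchyIntegral hγ.continuous hper hcd.continuousOn hw).congr_deriv ?_
    have hne : ∀ s, γ s - w ≠ 0 := fun s h => hw ⟨s, sub_eq_zero.1 h⟩
    have h1 : ∀ s ∈ uIcc (0 : ℝ) 1,
        HasDerivAt (fun s => -(γ s - w)⁻¹) (deriv γ s / (γ s - w) ^ 2) s := by
      intro s _
      have := (((hγ.differentiable one_ne_zero s).hasDerivAt.sub_const w).fun_inv (hne s)).neg
      refine this.congr_deriv ?_
      rw [neg_div, neg_neg]
    rw [intervalIntegral.integral_eq_sub_of_hasDerivAt h1]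
    · have := hper 0
      rw [zero_add] at this
      simp [this]
    · exact (hcd.div (by fun_prop) fun s => pow_ne_zero 2 (hne s)).intervalIntegrable _ _
  set V := connectedComponentIn (range γ)ᶜ z
  have hV : IsOpen V := hU.connectedComponentIn
  have hVs : V ⊆ (range γ)ᶜ := connectedComponentIn_subset _ _
  have hzV : z ∈ V := mem_connectedComponentIn hz
  have hconst : ∀ w ∈ V, N w = N z := fun w hw =>
    hV.is_const_of_deriv_eq_zero isPreconnected_connectedComponentIn
      (fun u hu => (hd u (hVs hu)).differentiableAt.differentiableWithinAt)
      (fun u hu => (hd u (hVs hu)).deriv) hw hzV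
  have hunb : ¬ Bornology.IsBounded V := fun hb => hz' ⟨hz, hb⟩
  -- An unbounded component reaches every neighbourhood of infinity, where `N` tends to `0`.
  have hfreq : ∃ᶠ w in cocompact ℂ, w ∈ V := by
    rw [← Metric.cobounded_eq_cocompact]
    intro h
    exact hunb (by rw [Bornology.isBounded_def]; exact h)
  have hlim := tendsto_cauchyIntegral_cocompact hγ.continuous (ψ := deriv γ) hcd.continuousOn
  by_contra hne
  have hev : ∀ᶠ w in cocompact ℂ, N w ≠ N z :=
    hlim.eventually (isOpen_ne.mem_nhds (x := (0 : ℂ)) (Ne.symm hne))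
  obtain ⟨w, hw, hw'⟩ := (hfreq.and_eventually hev).exists
  exact hw' (hconst w hw)

theorem dslope_comm (g : ℂ → ℂ) (z w : ℂ) : dslope g z w = dslope g w z := by
  rcases eq_or_ne z w with rfl | h
  · rfl
  · rw [dslope_of_ne _ h.symm, dslope_of_ne _ h, slope_comm]

/-- Cauchy's theorem for a closed curve whose inner domain lies in the domain of holomorphy. -/
theorem integral_comp_mul_deriv_eq_zero (hγ : ContDiff ℝ 1 γ) (hper : Function.Periodic γ 1)
    {U : Set ℂ} (hU : IsOpen U) (hLU : range γ ⊆ U) (hDU : innerDomain γ ⊆ U)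
    {g : ℂ → ℂ} (hg : DifferentiableOn ℂ g U) :
    ∫ s in (0 : ℝ)..1, g (γ s) * deriv γ s = 0 := by
  classical
  have hcd : Continuous (deriv γ) := hγ.continuous_deriv le_rfl
  have hγc := hγ.continuous
  -- The factor vanishing at `γ 0` makes `dslope G (γ 0)` equal to `g` on the curve, so the
  -- auxiliary function at `γ 0` is the integral sought.
  set G : ℂ → ℂ := fun w => g w * (w - γ 0)
  have hG : DifferentiableOn ℂ G U := hg.mul (by fun_prop)
  have hmem : ∀ s, γ s ∈ U := fun s => hLU ⟨s, rfl⟩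
  have hGγ : Continuous fun s => G (γ s) := hG.continuousOn.comp_continuous hγc hmem
  have hψ : Continuous fun s => G (γ s) * deriv γ s := hGγ.mul hcd
  have hds : ∀ w ∈ U, DifferentiableOn ℂ (dslope G w) U := fun w hw =>
    (Complex.differentiableOn_dslope (hU.mem_nhds hw)).2 hG
  have hdsγ : ∀ w ∈ U, Continuous fun s => dslope G w (γ s) := fun w hw =>
    (hds w hw).continuousOn.comp_continuous hγc hmem
  set h₁ : ℂ → ℂ := fun z => ∫ s in (0 : ℝ)..1, dslope G z (γ s) * deriv γ s
  set h₂ : ℂ → ℂ := fun z => ∫ s in (0 : ℝ)..1, G (γ s) * deriv γ s / (γ s - z)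
  -- Dixon's function: the two formulas differ by `G z` times the winding integral, so they agree on
  -- the part of `U` outside the curve and its inner domain. It is entire and tends to `0` at
  -- infinity, hence zero by Liouville.
  set h : ℂ → ℂ := fun z => if z ∈ U then h₁ z else h₂ z
  have hV : ∀ z, z ∉ range γ → z ∉ innerDomain γ → h z = h₂ z := by
    intro z hz hz'
    simp only [h]
    split_ifs with hzU
    · have hne : ∀ s, γ s - z ≠ 0 := fun s h => hz ⟨s, sub_eq_zero.1 h⟩
      have h3 : ∀ s, dslope G z (γ s) * deriv γ s =
          G (γ s) * deriv γ s / (γ s - z) - G z * (deriv γ s / (γ s - z)) := by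
        intro s
        rw [dslope_of_ne _ (sub_ne_zero.1 (hne s)), slope_def_field]
        ring
      simp only [h₁, h₂, h3]
      rw [intervalIntegral.integral_sub, intervalIntegral.integral_const_mul,
        integral_winding_eq_zero hγ hper hz hz', mul_zero, sub_zero]
      · exact (hψ.div (by fun_prop) hne).intervalIntegrable _ _
      · exact ((hcd.div (by fun_prop) hne).const_mul _).intervalIntegrable _ _
    · rfl
  have hd₁ : ∀ z ∈ U, DifferentiableAt ℂ h₁ z := by
    intro z hz
    refine (hasDerivAt_intervalIntegral_of_holomorphic
      (F := fun z s => dslope G z (γ s) * deriv γ s) hU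
      (fun w hw => ((hdsγ w hw).mul hcd).continuousOn) (fun s _ => ?_) ?_ hz).differentiableAt
    · have : (fun w => dslope G w (γ s) * deriv γ s) =
          fun w => dslope G (γ s) w * deriv γ s := by
        ext w
        rw [dslope_comm]
      rw [this]
      exact (hds _ (hmem s)).mul_const _
    · intro w hw
      obtain ⟨D, hD⟩ := (isCompact_Icc (a := (0 : ℝ)) (b := 1)).exists_bound_of_continuousOn
        hcd.continuousOn
      obtain ⟨E, hE⟩ := (isCompact_Icc (a := (0 : ℝ)) (b := 1)).exists_bound_of_continuousOn
        hGγ.continuousOn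
      have hGdC : ContinuousOn (deriv G) U := (hG.deriv hU).continuousOn
      obtain ⟨R, hR, hRU⟩ := Metric.isOpen_iff.1 hU w hw
      have hcb : Metric.closedBall w (R / 2) ⊆ U := fun u hu => hRU (by
        rw [Metric.mem_ball]; rw [Metric.mem_closedBall] at hu; linarith)
      obtain ⟨M, hM⟩ := (isCompact_closedBall w (R / 2)).exists_bound_of_continuousOn
        (hGdC.mono hcb)
      obtain ⟨K, hK⟩ := (isCompact_closedBall w (R / 2)).exists_bound_of_continuousOn
        (hG.continuousOn.mono hcb)
      have hE0 : 0 ≤ E := (norm_nonneg _).trans (hE 0 (by simp))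
      have hK0 : 0 ≤ K := (norm_nonneg _).trans (hK w (by simp; positivity))
      -- Curve points in the closed ball of radius `R / 2` are handled by the mean value inequality;
      -- all others are at distance at least `R / 4` from `u`.
      refine ⟨R / 4, by positivity, max M ((E + K) / (R / 4)) * D, fun u hu s hs => ?_⟩
      have hu' : u ∈ Metric.closedBall w (R / 2) := by
        rw [Metric.mem_ball] at hu; rw [Metric.mem_closedBall]; linarith
      rw [norm_mul]
      refine mul_le_mul ?_ (hD s hs) (norm_nonneg _) ?_
      swap
      · exact le_trans (by positivity) (le_max_right _ _)
      rcases eq_or_ne (γ s) u with heq | hne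
      · rw [heq, dslope_same]
        exact (hM u hu').trans (le_max_left _ _)
      rw [dslope_of_ne _ hne, slope_def_field, norm_div]
      by_cases hs' : γ s ∈ Metric.closedBall w (R / 2)
      · refine le_trans ?_ (le_max_left _ _)
        have := (convex_closedBall w (R / 2)).norm_image_sub_le_of_norm_deriv_le
          (fun y hy => hG.differentiableAt (hU.mem_nhds (hcb hy))) hM hu' hs'
        rwa [div_le_iff₀ (norm_pos_iff.2 (sub_ne_zero.2 hne))]
      · refine le_trans ?_ (le_max_right _ _)
        have h5 : R / 4 ≤ ‖γ s - u‖ := by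
          rw [← dist_eq_norm]
          rw [Metric.mem_closedBall, not_le] at hs'
          rw [Metric.mem_ball] at hu
          linarith [dist_triangle (γ s) u w]
        have h6 : ‖G (γ s) - G u‖ ≤ E + K :=
          (norm_sub_le _ _).trans (add_le_add (hE s hs) (hK u hu'))
        exact div_le_div₀ (by positivity) h6 (by positivity) h5
  have hLo : IsOpen (range γ)ᶜ := (isCompact_range_of_periodic hγc hper).isClosed.isOpen_compl
  have hdiff : Differentiable ℂ h := by
    intro z
    by_cases hz : z ∈ U
    · refine (hd₁ z hz).congr_of_eventuallyEq ?_
      filter_upwards [hU.mem_nhds hz] with w hw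
      simp [h, hw]
    · have hz1 : z ∉ range γ := fun hh => hz (hLU hh)
      have hz2 : z ∉ innerDomain γ := fun hh => hz (hDU hh)
      refine (hasDerivAt_cauchyIntegral hγc hper hψ.continuousOn
        hz1).differentiableAt.congr_of_eventuallyEq ?_
      -- The whole component of `z` lies outside the inner domain, so `h` is given by `h₂` near `z`,
      -- even at points of `U`.
      filter_upwards [hLo.connectedComponentIn.mem_nhds (mem_connectedComponentIn hz1)] with w hw
      refine hV w (connectedComponentIn_subset _ _ hw) fun hw' => hz2 ⟨hz1, ?_⟩
      rw [connectedComponentIn_eq hw]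
      exact hw'.2
  have hlim : Tendsto h (cocompact ℂ) (𝓝 0) := by
    refine (tendsto_cauchyIntegral_cocompact hγc hψ.continuousOn).congr' ?_
    obtain ⟨R, hR⟩ := (isCompact_range_of_periodic hγc hper).isBounded.exists_norm_le
    filter_upwards [(tendsto_norm_cocompact_atTop (E := ℂ)).eventually_gt_atTop R] with z hz
    refine (hV z ?_ (notMem_innerDomain_of_lt_norm (fun s => hR _ ⟨s, rfl⟩) hz)).symm
    intro hz'
    exact absurd (hR z hz') (not_le.2 hz)
  have h0 : h (γ 0) = 0 := hdiff.apply_eq_of_tendsto_cocompact _ hlim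
  simp only [h, hmem 0, if_true, h₁] at h0
  rw [← h0]
  congr 1
  ext s
  congr 1
  rcases eq_or_ne (γ s) (γ 0) with heq | hne
  · rw [heq, dslope_same]
    have hd : HasDerivAt G _ (γ 0) := ((hg.differentiableAt (hU.mem_nhds (hmem 0))).hasDerivAt).mul
      ((hasDerivAt_id (γ 0)).sub_const (γ 0))
    rw [hd.deriv]
    simp
  · rw [dslope_of_ne _ hne, slope_def_field]
    have := sub_ne_zero.2 hne
    simp only [G]
    field_simp
    ring
end Cauchy

/-! ### Geometry of the cut contour. -/

/-- A regular arc starting at `0` leaves each small disc around `0` exactly once. -/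
theorem exists_exit_param {c : ℝ → ℂ} (hc : ContDiff ℝ 1 c) (h0 : c 0 = 0) (hd : deriv c 0 ≠ 0)
    (hne : ∀ s ∈ Ioc (0 : ℝ) (1 / 2), c s ≠ 0) :
    ∃ β : ℝ → ℝ, Tendsto β (𝓝[>] 0) (𝓝[>] 0) ∧ ∀ᶠ v in 𝓝[>] (0 : ℝ), ‖c (β v)‖ = v ∧
      β v < 1 / 2 ∧ ∀ s ∈ Icc (0 : ℝ) (1 / 2), (v < ‖c s‖ ↔ β v < s) := by
  have hcd : Continuous (deriv c) := hc.continuous_deriv le_rfl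
  have hcc : Continuous c := hc.continuous
  have hdiff : ∀ s, HasDerivAt c (deriv c s) s := fun s =>
    (hc.differentiable one_ne_zero s).hasDerivAt
  -- The derivative of `‖c‖²` is `2⟨c, c'⟩`, and `⟨c / s, c'⟩` tends to `‖c' 0‖² > 0`; hence `‖c‖`
  -- is strictly increasing near `0`.
  have hlim : Tendsto (fun s : ℝ => inner ℝ (s⁻¹ • c s) (deriv c s)) (𝓝[>] 0)
      (𝓝 (inner ℝ (deriv c 0) (deriv c 0))) := by
    refine Tendsto.inner ?_ ((hcd.tendsto 0).mono_left nhdsWithin_le_nhds)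
    have := (hasDerivAt_iff_tendsto_slope_zero.1 (hdiff 0)).mono_left
      (nhdsWithin_mono 0 (show Ioi (0 : ℝ) ⊆ {0}ᶜ from fun s hs => (ne_of_gt hs)))
    simpa [h0] using this
  have hpos : ∀ᶠ s in 𝓝[>] (0 : ℝ), 0 < inner ℝ (s⁻¹ • c s) (deriv c s) :=
    hlim.eventually (lt_mem_nhds (real_inner_self_pos.2 hd))
  obtain ⟨δ', hδ', hδ'pos⟩ := mem_nhdsGT_iff_exists_Ioo_subset.1 hpos
  set δ := min δ' (1 / 2) with hδ
  have hδ0 : 0 < δ := lt_min hδ' (by norm_num)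
  have hδ2 : δ ≤ 1 / 2 := min_le_right _ _
  have hmono2 : StrictMonoOn (fun s => ‖c s‖ ^ 2) (Icc 0 δ) := by
    refine strictMonoOn_of_deriv_pos (convex_Icc _ _) (by fun_prop) fun s hs => ?_
    rw [interior_Icc] at hs
    rw [(hdiff s).norm_sq.deriv]
    have h1 := hδ'pos ⟨hs.1, hs.2.trans_le (min_le_left _ _)⟩
    simp only [mem_ofPred_eq, inner_smul_left, conj_trivial] at h1
    have h2 := pos_of_mul_pos_right h1 (inv_pos.2 hs.1).le
    linarith
  have hmono : StrictMonoOn (fun s => ‖c s‖) (Icc 0 δ) := fun a ha b hb hab =>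
    lt_of_pow_lt_pow_left₀ 2 (norm_nonneg _) (hmono2 ha hb hab)
  -- Below the minimum of `‖c‖` on `[δ, 1/2]`, a radius can only be met on the monotone piece.
  obtain ⟨m, hm, hmin⟩ := (isCompact_Icc (a := δ) (b := 1 / 2)).exists_isMinOn
    ⟨δ, left_mem_Icc.2 hδ2⟩ (f := fun s => ‖c s‖) (by fun_prop)
  have hm0 : 0 < ‖c m‖ := norm_pos_iff.2 (hne m ⟨hδ0.trans_le hm.1, hm.2⟩)
  have hmδ : ‖c m‖ ≤ ‖c δ‖ := hmin (left_mem_Icc.2 hδ2)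
  have hex : ∀ v ∈ Ioo 0 ‖c m‖, ∃ b ∈ Icc 0 δ, ‖c b‖ = v := by
    intro v hv
    have := intermediate_value_Icc hδ0.le (f := fun s => ‖c s‖) (by fun_prop)
    refine this ⟨?_, (hv.2.trans_le hmδ).le⟩
    simpa [h0] using hv.1.le
  choose! β hβ hβv using hex
  have hIoo : ∀ᶠ v in 𝓝[>] (0 : ℝ), v ∈ Ioo 0 ‖c m‖ := Ioo_mem_nhdsGT hm0
  have hβδ : ∀ v ∈ Ioo 0 ‖c m‖, β v < δ := by
    intro v hv
    refine lt_of_le_of_ne (hβ v hv).2 fun h => ?_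
    have := hβv v hv
    rw [h] at this
    linarith [hv.2]
  have hiff : ∀ v ∈ Ioo 0 ‖c m‖, ∀ s ∈ Icc (0 : ℝ) (1 / 2), (v < ‖c s‖ ↔ β v < s) := by
    intro v hv s hs
    rcases le_total s δ with h | h
    · conv_lhs => rw [← hβv v hv]
      exact hmono.lt_iff_lt (hβ v hv) ⟨hs.1, h⟩
    · have h1 : ‖c m‖ ≤ ‖c s‖ := hmin ⟨h, hs.2⟩
      exact ⟨fun _ => (hβδ v hv).trans_le h, fun _ => hv.2.trans_le h1⟩
  refine ⟨β, tendsto_nhdsWithin_iff.2 ⟨?_, ?_⟩, ?_⟩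
  · refine tendsto_order.2 ⟨fun a ha => ?_, fun a ha => ?_⟩
    · filter_upwards [hIoo] with v hv using ha.trans_le (hβ v hv).1
    · set e := min a (1 / 2)
      have he : e ∈ Ioc (0 : ℝ) (1 / 2) := ⟨lt_min ha (by norm_num), min_le_right _ _⟩
      filter_upwards [hIoo, Ioo_mem_nhdsGT (norm_pos_iff.2 (hne e he))] with v hv hv'
      exact ((hiff v hv e (Ioc_subset_Icc_self he)).1 hv'.2).trans_le (min_le_left _ _)
  · filter_upwards [hIoo] with v hv
    refine lt_of_le_of_ne (hβ v hv).1 fun h => ?_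
    have := hβv v hv
    rw [← h, h0, norm_zero] at this
    linarith [hv.1]
  · filter_upwards [hIoo] with v hv
    exact ⟨hβv v hv, (hβδ v hv).trans_le hδ2, hiff v hv⟩

section Contour

variable {p : ℕ} {γ : ℝ → ℂ}

theorem IsSmoothContour.contDiff_one (hγ : IsSmoothContour p γ) (hp : 1 ≤ p) : ContDiff ℝ 1 γ :=
  hγ.contDiff.of_le (by exact_mod_cast hp)

/-- Injectivity on one period gives injectivity modulo `1`: equal values force equal fractional
parts, and no integer lies strictly between `0` and `1`. -/
theorem IsSmoothContour.add_ne (hγ : IsSmoothContour p γ) (s₀ : ℝ) {s : ℝ} (hs : s ∈ Ioo (0 : ℝ) 1) :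
    γ (s₀ + s) ≠ γ s₀ := by
  have hfr : ∀ u, γ (Int.fract u) = γ u := fun u => by
    have := hγ.periodic.sub_int_mul_eq ⌊u⌋ (x := u)
    rwa [mul_one] at this
  intro h
  rw [← hfr (s₀ + s), ← hfr s₀] at h
  have h1 := hγ.injOn ⟨Int.fract_nonneg _, Int.fract_lt_one _⟩
    ⟨Int.fract_nonneg _, Int.fract_lt_one _⟩ h
  obtain ⟨z, hz⟩ := Int.fract_eq_fract.1 h1
  have h2 : s = z := by linarith
  have h3 := hs.1
  have h4 := hs.2
  rw [h2] at h3 h4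
  have h5 : 0 < z := by exact_mod_cast h3
  have h6 : z < 1 := by exact_mod_cast h4
  omega

/-- Near a point `γ s₀`, the cut contour is a single arc, whose ends tend to `γ s₀`. -/
theorem IsSmoothContour.exists_cut (hγ : IsSmoothContour p γ) (hp : 1 ≤ p) (s₀ : ℝ) :
    ∃ α β : ℝ → ℝ, Tendsto α (𝓝[>] 0) (𝓝[>] 0) ∧ Tendsto β (𝓝[>] 0) (𝓝[>] 0) ∧
      ∀ᶠ v in 𝓝[>] (0 : ℝ), α v < 1 / 2 ∧ β v < 1 / 2 ∧ ‖γ (s₀ - α v) - γ s₀‖ = v ∧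
        ‖γ (s₀ + β v) - γ s₀‖ = v ∧ ∀ F : ℝ → ℂ, Function.Periodic F 1 →
          ∫ s in cutParam γ (γ s₀) v, F s = ∫ s in (s₀ + β v)..(s₀ + 1 - α v), F s := by
  have h1 := hγ.contDiff_one hp
  have hdiff : ∀ s, HasDerivAt γ (deriv γ s) s := fun s =>
    (h1.differentiable one_ne_zero s).hasDerivAt
  have hperv : ∀ s, γ (s + 1) = γ s := hγ.periodic
  obtain ⟨β, hβ, hβ'⟩ := exists_exit_param (c := fun s => γ (s₀ + s) - γ s₀)
    (by fun_prop) (by simp)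
    (by
      have h := ((hdiff (s₀ + 0)).comp_const_add s₀ 0).sub_const (γ s₀)
      rw [h.deriv]
      exact hγ.deriv_ne_zero _)
    (fun s hs => sub_ne_zero.2 (hγ.add_ne s₀ ⟨hs.1, by linarith [hs.2]⟩))
  obtain ⟨α, hα, hα'⟩ := exists_exit_param (c := fun s => γ (s₀ - s) - γ s₀)
    (by fun_prop) (by simp)
    (by
      have h := ((hdiff (s₀ - 0)).comp_const_sub s₀ 0).sub_const (γ s₀)
      rw [h.deriv]
      exact neg_ne_zero.2 (hγ.deriv_ne_zero _))
    (fun s hs => by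
      have := hγ.add_ne (s₀ - s) (s := s) ⟨hs.1, by linarith [hs.2]⟩
      rw [sub_add_cancel] at this
      exact sub_ne_zero.2 this.symm)
  refine ⟨α, β, hα, hβ, ?_⟩
  filter_upwards [hα', hβ', (tendsto_nhdsWithin_iff.1 hα).2, (tendsto_nhdsWithin_iff.1 hβ).2,
    self_mem_nhdsWithin] with v hav hbv ha0 hb0 hv0
  refine ⟨hav.2.1, hbv.2.1, hav.1, hbv.1, fun F hF => ?_⟩
  rw [mem_Ioi] at ha0 hb0
  set S : Set ℝ := {s | v < ‖γ s - γ s₀‖}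
  have hS : MeasurableSet S :=
    (isOpen_lt continuous_const (by fun_prop : Continuous fun s => ‖γ s - γ s₀‖)).measurableSet
  have hper : Function.Periodic (S.indicator F) 1 := by
    intro s
    simp only [indicator, S, mem_ofPred_eq, hperv, hF s]
  have e1 : ∫ s in cutParam γ (γ s₀) v, F s = ∫ s in (0 : ℝ)..1, S.indicator F s := by
    have : cutParam γ (γ s₀) v = Ico 0 1 ∩ S := rfl
    rw [this, ← setIntegral_indicator hS, intervalIntegral.integral_of_le zero_le_one,
      integral_Ico_eq_integral_Ioc]
  have e2 := hper.intervalIntegral_add_eq 0 s₀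
  rw [zero_add] at e2
  have e3 : Ioc s₀ (s₀ + 1) ∩ S = Ioo (s₀ + β v) (s₀ + 1 - α v) := by
    ext s
    simp only [mem_inter_iff, mem_Ioc, mem_Ioo, S, mem_ofPred_eq]
    -- The first half period is governed by the forward exit parameter, the second, moved back by
    -- one period, by the backward one.
    rcases le_total s (s₀ + 1 / 2) with h | h
    · constructor
      · rintro ⟨⟨ha, -⟩, hb⟩
        have := (hbv.2.2 (s - s₀) ⟨by linarith, by linarith⟩).1 (by simpa using hb)
        exact ⟨by linarith, by linarith [hav.2.1]⟩
      · rintro ⟨ha, -⟩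
        have := (hbv.2.2 (s - s₀) ⟨by linarith, by linarith⟩).2 (by linarith)
        exact ⟨⟨by linarith, by linarith⟩, by simpa using this⟩
    · have hs1 : γ (s₀ - (s₀ + 1 - s)) = γ s := by
        rw [← hperv (s₀ - (s₀ + 1 - s))]
        congr 1
        ring
      constructor
      · rintro ⟨⟨-, ha⟩, hb⟩
        have := (hav.2.2 (s₀ + 1 - s) ⟨by linarith, by linarith⟩).1 (by
          rw [hs1]; exact hb)
        exact ⟨by linarith [hbv.2.1], by linarith⟩
      · rintro ⟨-, ha⟩
        have := (hav.2.2 (s₀ + 1 - s) ⟨by linarith, by linarith⟩).2 (by linarith)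
        rw [hs1] at this
        exact ⟨⟨by linarith, by linarith⟩, this⟩
  rw [e1, e2, intervalIntegral.integral_of_le (by linarith), setIntegral_indicator hS, e3,
    intervalIntegral.integral_of_le (by linarith [hav.2.1, hbv.2.1]),
    integral_Ioc_eq_integral_Ioo]

end Contour

/-! ### The principal value. -/

/-- The logarithmic derivative of a path in the slit plane integrates to the logarithm. -/
theorem integral_deriv_div_eq_log_sub {f f' : ℝ → ℂ} (hf : ∀ s, HasDerivAt f (f' s) s)
    (hf' : Continuous f') {a b : ℝ} (hab : a ≤ b) (hs : ∀ s ∈ Icc a b, f s ∈ Complex.slitPlane) :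
    ∫ s in a..b, f' s / f s = Complex.log (f b) - Complex.log (f a) := by
  have hfc : Continuous f := continuous_iff_continuousAt.2 fun s => (hf s).continuousAt
  refine intervalIntegral.integral_eq_sub_of_hasDerivAt (f := fun s => Complex.log (f s))
    (fun s hs' => ?_) ?_
  · rw [uIcc_of_le hab] at hs'
    exact (hf s).clog_real (hs s hs')
  · refine ContinuousOn.intervalIntegrable ?_
    rw [uIcc_of_le hab]
    exact hf'.continuousOn.div hfc.continuousOn
      fun s hs' => Complex.slitPlane_ne_zero (hs s hs')

/-- The argument of `w` lies in `(-π/2, π/2)`, so a quarter turn does not leave the principal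
branch. -/
theorem log_I_mul {w : ℂ} (hw : 0 < w.re) :
    Complex.log (Complex.I * w) = Complex.log w + Real.pi / 2 * Complex.I := by
  have h0 : w ≠ 0 := fun h => by simp [h] at hw
  have h1 := abs_lt.1 (Complex.abs_arg_lt_pi_div_two_iff.2 (Or.inl hw))
  have := Real.pi_pos
  rw [Complex.log_mul Complex.I_ne_zero h0, Complex.log_I, add_comm]
  rw [Complex.arg_I]
  constructor <;> linarith

theorem log_neg_I_mul {w : ℂ} (hw : 0 < w.re) :
    Complex.log (-Complex.I * w) = Complex.log w - Real.pi / 2 * Complex.I := by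
  have h0 : w ≠ 0 := fun h => by simp [h] at hw
  have h1 := abs_lt.1 (Complex.abs_arg_lt_pi_div_two_iff.2 (Or.inl hw))
  have := Real.pi_pos
  rw [Complex.log_mul (neg_ne_zero.2 Complex.I_ne_zero) h0, Complex.log_neg_I]
  · ring
  rw [Complex.arg_neg_I]
  constructor <;> linarith

/-- The arc crosses the imaginary axis near `0` only at `0`, so explicit logarithms compute its
contribution to the winding integrals at `±iε` and to the principal value. No knowledge of which
side is the inner one is needed. -/
theorem tendsto_principalValue_of_deriv_eq_one {c : ℝ → ℂ} (hc : ContDiff ℝ 1 c)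
    (hper : Function.Periodic c 1) (h0 : c 0 = 0) (h1 : deriv c 0 = 1)
    (hne : ∀ s ∈ Ioo (0 : ℝ) 1, c s ≠ 0)
    (hw : ∀ z ∉ range c, ∫ s in (0 : ℝ)..1, deriv c s / (c s - z) = 0 ∨
      ∫ s in (0 : ℝ)..1, deriv c s / (c s - z) = 2 * Real.pi * Complex.I)
    {α β : ℝ → ℝ} (hα : Tendsto α (𝓝[>] 0) (𝓝[>] 0)) (hβ : Tendsto β (𝓝[>] 0) (𝓝[>] 0))
    (hαβ : ∀ᶠ v in 𝓝[>] (0 : ℝ), ‖c (-α v)‖ = ‖c (β v)‖) :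
    Tendsto (fun v => ∫ s in (β v)..(1 - α v), deriv c s / c s) (𝓝[>] 0)
      (𝓝 (Real.pi * Complex.I)) := by
  have hcc : Continuous c := hc.continuous
  have hcd : Continuous (deriv c) := hc.continuous_deriv le_rfl
  have hdiff : ∀ s, HasDerivAt c (deriv c s) s := fun s =>
    (hc.differentiable one_ne_zero s).hasDerivAt
  have hperd := periodic_deriv hper
  have hquot : Tendsto (fun s : ℝ => (s : ℂ)⁻¹ * c s) (𝓝[≠] 0) (𝓝 1) := by
    have := hasDerivAt_iff_tendsto_slope_zero.1 (hdiff 0)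
    simpa [h0, h1] using this
  have hre : ∀ᶠ s : ℝ in 𝓝[≠] 0, 0 < ((s : ℂ)⁻¹ * c s).re :=
    ((Complex.continuous_re.tendsto 1).comp hquot).eventually (lt_mem_nhds (by simp))
  have hre' : ∀ s : ℝ, ((s : ℂ)⁻¹ * c s).re = s⁻¹ * (c s).re := fun s => by
    rw [← Complex.ofReal_inv, Complex.re_ofReal_mul]
  obtain ⟨δ', hδ', hball⟩ := Metric.mem_nhdsWithin_iff.1 hre
  set δ := min (δ' / 2) (1 / 4)
  have hδ0 : 0 < δ := by positivity
  have hδ4 : δ ≤ 1 / 4 := min_le_right _ _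
  have hδδ' : δ < δ' := (min_le_left _ _).trans_lt (by linarith)
  have hpos : ∀ s ∈ Icc (-δ) δ, s ≠ 0 → 0 < s⁻¹ * (c s).re := by
    intro s hs hs0
    rw [← hre']
    refine hball ⟨?_, hs0⟩
    rw [Metric.mem_ball, Real.dist_eq, sub_zero]
    exact (abs_le.2 hs).trans_lt hδδ'
  have hrp : ∀ s ∈ Ioc 0 δ, 0 < (c s).re := fun s hs =>
    pos_of_mul_pos_right (hpos s ⟨by linarith [hs.1], hs.2⟩ hs.1.ne') (inv_pos.2 hs.1).le
  have hrn : ∀ s ∈ Ico (-δ) 0, 0 < (-c s).re := fun s hs => by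
    have := hpos s ⟨hs.1, by linarith [hs.2]⟩ hs.2.ne
    have h2 := neg_of_mul_pos_right this (inv_lt_zero.2 hs.2).le
    simpa using h2
  have hre0 : ∀ s ∈ Icc (-δ) δ, (c s).re = 0 → s = 0 := by
    intro s hs h
    by_contra hs0
    have := hpos s hs hs0
    rw [h, mul_zero] at this
    exact lt_irrefl _ this
  -- For imaginary `κ` the path `κ c + ε` avoids the cut of the logarithm: its imaginary part is
  -- `κ.im * re c`, zero only at `s = 0`, where the value is `ε > 0`.
  have hloc : ∀ κ : ℂ, κ.re = 0 → κ.im ≠ 0 → ∀ ε : ℝ, 0 < ε →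
      ∫ s in (-δ)..δ, deriv c s / (c s + ε / κ) =
        Complex.log (κ * c δ + ε) - Complex.log (κ * c (-δ) + ε) := by
    intro κ hκ hκ' ε hε
    have hκ0 : κ ≠ 0 := fun h => hκ' (by simp [h])
    have := integral_deriv_div_eq_log_sub (f := fun s => κ * c s + ε) (f' := fun s => κ * deriv c s)
      (fun s => ((hdiff s).const_mul κ).add_const _) (by fun_prop) (a := -δ) (b := δ)
      (by linarith) (fun s hs => ?_)
    · rw [← this]
      congr 1
      ext s
      rw [show κ * c s + ε = κ * (c s + ε / κ) by field_simp, mul_div_mul_left _ _ hκ0]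
    · rw [Complex.mem_slitPlane_iff]
      by_cases h : (c s).re = 0
      · left
        have hs0 := hre0 s hs h
        simp [hs0, h0, hε]
      · right
        simp [hκ, hκ', h]
  obtain ⟨m', hm', hmin⟩ := (isCompact_Icc (a := δ) (b := 1 - δ)).exists_isMinOn
    ⟨δ, left_mem_Icc.2 (by linarith)⟩ (f := fun s => ‖c s‖) (by fun_prop)
  set m := ‖c m'‖
  have hm0 : 0 < m := norm_pos_iff.2 (hne m' ⟨hδ0.trans_le hm'.1, by linarith [hm'.2]⟩)
  obtain ⟨M, hM⟩ := (isCompact_Icc (a := δ) (b := 1 - δ)).exists_bound_of_continuousOn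
    hcd.continuousOn
  have hM0 : 0 ≤ M := (norm_nonneg _).trans (hM m' hm')
  set K := ∫ s in δ..(1 - δ), deriv c s / c s
  have hfar : ∀ κ : ℂ, Tendsto (fun ε : ℝ => ∫ s in δ..(1 - δ), deriv c s / (c s + ε / κ))
      (𝓝[>] 0) (𝓝 K) := by
    intro κ
    have hz : Tendsto (fun ε : ℝ => (ε / κ : ℂ)) (𝓝[>] 0) (𝓝 0) := by
      have : Continuous fun ε : ℝ => (ε / κ : ℂ) := by fun_prop
      simpa using (this.tendsto 0).mono_left nhdsWithin_le_nhds
    refine intervalIntegral.tendsto_integral_filter_of_dominated_convergence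
      (fun _ => M / (m / 2)) ?_ ?_ (by simp) ?_
    · refine Eventually.of_forall fun ε => ?_
      exact (hcd.measurable.div (hcc.measurable.add_const _)).aestronglyMeasurable
    · filter_upwards [hz.eventually (Metric.ball_mem_nhds 0 (half_pos hm0))] with ε hε
      refine Eventually.of_forall fun s hs => ?_
      rw [uIoc_of_le (by linarith)] at hs
      have hs' := Ioc_subset_Icc_self hs
      rw [norm_div]
      refine div_le_div₀ hM0 (hM s hs') (by positivity) ?_
      rw [dist_zero_right] at hε
      have h3 : m ≤ ‖c s‖ := hmin hs'
      have h4 := norm_sub_le (c s + ε / κ) (ε / κ)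
      rw [add_sub_cancel_right] at h4
      linarith
    · refine Eventually.of_forall fun s hs => ?_
      rw [uIoc_of_le (by linarith)] at hs
      have hcs : c s ≠ 0 := hne s ⟨by linarith [hs.1], by linarith [hs.2]⟩
      have h5 : Tendsto (fun ε : ℝ => c s + ε / κ) (𝓝[>] 0) (𝓝 (c s)) := by
        simpa using hz.const_add (c s)
      exact tendsto_const_nhds.div h5 hcs
  have hwind : ∀ κ : ℂ, κ.re = 0 → κ.im ≠ 0 →
      K + (Complex.log (κ * c δ) - Complex.log (κ * c (-δ))) = 0 ∨
      K + (Complex.log (κ * c δ) - Complex.log (κ * c (-δ))) = 2 * Real.pi * Complex.I := by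
    intro κ hκ hκ'
    have hκ0 : κ ≠ 0 := fun h => hκ' (by simp [h])
    have hz : Tendsto (fun ε : ℝ => (ε / κ : ℂ)) (𝓝[>] 0) (𝓝 0) := by
      have : Continuous fun ε : ℝ => (ε / κ : ℂ) := by fun_prop
      simpa using (this.tendsto 0).mono_left nhdsWithin_le_nhds
    have hlog : ∀ s : ℝ, (c s).re ≠ 0 →
        Tendsto (fun ε : ℝ => Complex.log (κ * c s + ε)) (𝓝[>] 0)
          (𝓝 (Complex.log (κ * c s))) := by
      intro s hs
      have h6 : Tendsto (fun ε : ℝ => κ * c s + ε) (𝓝[>] 0) (𝓝 (κ * c s)) := by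
        have : Continuous fun ε : ℝ => κ * c s + (ε : ℂ) := by fun_prop
        simpa using (this.tendsto 0).mono_left nhdsWithin_le_nhds
      refine h6.clog ?_
      rw [Complex.mem_slitPlane_iff]
      right
      simp [hκ, hκ', hs]
    have hlim : Tendsto (fun ε : ℝ => ∫ s in (0 : ℝ)..1, deriv c s / (c s - -(ε / κ)))
        (𝓝[>] 0) (𝓝 (K + (Complex.log (κ * c δ) - Complex.log (κ * c (-δ))))) := by
      refine Tendsto.congr' ?_ ((hfar κ).add ((hlog δ ?_).sub (hlog (-δ) ?_)))
      · filter_upwards [self_mem_nhdsWithin, hz.eventually (Metric.ball_mem_nhds 0 hm0)]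
          with ε hε hεm
        rw [dist_zero_right] at hεm
        rw [mem_Ioi] at hε
        have hP : Function.Periodic (fun s => deriv c s / (c s - -(ε / κ))) 1 := fun s => by
          simp only [hper s, hperd s]
        have e1 := hP.intervalIntegral_add_eq 0 (-δ)
        rw [zero_add] at e1
        have hnz1 : ∀ s ∈ Icc (-δ) δ, c s + ε / κ ≠ 0 := by
          intro s hs h
          have h7 : κ * c s + ε = 0 := by
            have : κ * (c s + ε / κ) = κ * c s + ε := by field_simp
            rw [← this, h, mul_zero]
          have h8 := congrArg Complex.im h7
          simp [hκ, hκ'] at h8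
          have hs0 := hre0 s hs h8
          rw [hs0, h0, mul_zero, zero_add] at h7
          exact hε.ne' (by exact_mod_cast h7)
        have hnz2 : ∀ s ∈ Icc δ (1 - δ), c s + ε / κ ≠ 0 := by
          intro s hs h
          have h9 : m ≤ ‖c s‖ := hmin hs
          rw [eq_neg_of_add_eq_zero_left h, norm_neg] at h9
          linarith
        rw [e1, ← hloc κ hκ hκ' ε hε, add_comm, show -δ + 1 = 1 - δ by ring]
        simp only [sub_neg_eq_add]
        refine intervalIntegral.integral_add_adjacent_intervals ?_ ?_
        · refine ContinuousOn.intervalIntegrable ?_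
          rw [uIcc_of_le (by linarith)]
          exact hcd.continuousOn.div (by fun_prop) hnz1
        · refine ContinuousOn.intervalIntegrable ?_
          rw [uIcc_of_le (by linarith)]
          exact hcd.continuousOn.div (by fun_prop) hnz2
      · exact (hrp δ ⟨hδ0, le_rfl⟩).ne'
      · have := hrn (-δ) ⟨le_rfl, by linarith⟩
        simp only [Complex.neg_re] at this
        linarith
    have hmem : ∀ᶠ ε : ℝ in 𝓝[>] 0, ∫ s in (0 : ℝ)..1, deriv c s / (c s - -(ε / κ)) ∈
        ({0, 2 * Real.pi * Complex.I} : Set ℂ) := by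
      filter_upwards [self_mem_nhdsWithin, hz.eventually (Metric.ball_mem_nhds 0 hm0)]
        with ε hε hεm
      rw [dist_zero_right] at hεm
      rw [mem_Ioi] at hε
      refine hw _ ?_
      rintro ⟨s, hs⟩
      obtain ⟨s', hs', hss'⟩ : ∃ s' ∈ Ico (-δ) (-δ + 1), c s = c s' :=
        hper.exists_mem_Ico one_pos s (-δ)
      rw [hss'] at hs
      rcases le_total s' δ with h | h
      · have hs'' := congrArg (fun z => (κ * z).im) hs
        simp only [mul_neg, mul_div_cancel₀ _ hκ0] at hs''
        simp [hκ, hκ'] at hs''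
        have hs0 := hre0 s' ⟨hs'.1, h⟩ hs''
        rw [hs0, h0] at hs
        have : (ε : ℂ) / κ = 0 := by rw [← neg_eq_zero, ← hs]
        rw [div_eq_zero_iff] at this
        rcases this with h | h
        · exact hε.ne' (by exact_mod_cast h)
        · exact hκ0 h
      · have h9 : m ≤ ‖c s'‖ := hmin ⟨h, by linarith [hs'.2]⟩
        rw [hs, norm_neg] at h9
        linarith
    have hcl : IsClosed ({0, 2 * Real.pi * Complex.I} : Set ℂ) := (Set.toFinite _).isClosed
    exact hcl.mem_of_tendsto hlim hmem
  have hp := hrp δ ⟨hδ0, le_rfl⟩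
  have hn := hrn (-δ) ⟨le_rfl, by linarith⟩
  -- For `κ = i` and `κ = -i` the expression in `hwind` is the left side here plus, respectively
  -- minus, `π i`. Both values lie in `{0, 2π i}` and differ by `2π i`, so the first is `2π i`.
  have hPV : K + (Complex.log (c δ) - Complex.log (-c (-δ))) = Real.pi * Complex.I := by
    have hA := hwind Complex.I (by simp) (by simp)
    have hB := hwind (-Complex.I) (by simp) (by simp)
    rw [log_I_mul hp, show Complex.I * c (-δ) = -Complex.I * -c (-δ) by ring,
      log_neg_I_mul hn] at hA
    rw [log_neg_I_mul hp, show -Complex.I * c (-δ) = Complex.I * -c (-δ) by ring,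
      log_I_mul hn] at hB
    have hpi : (Real.pi : ℂ) * Complex.I ≠ 0 :=
      mul_ne_zero (by exact_mod_cast Real.pi_ne_zero) Complex.I_ne_zero
    rcases hA with hA | hA
    · rcases hB with hB | hB
      · exact absurd (by linear_combination (hA - hB) / 2) hpi
      · exact absurd (by linear_combination (hA - hB) / 4) hpi
    · linear_combination hA
  have hquotα : Tendsto (fun v => ((-α v : ℝ) : ℂ)⁻¹ * c (-α v)) (𝓝[>] 0) (𝓝 1) := by
    refine hquot.comp (tendsto_nhdsWithin_iff.2 ⟨?_, ?_⟩)
    · simpa using (tendsto_nhdsWithin_iff.1 hα).1.neg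
    · filter_upwards [(tendsto_nhdsWithin_iff.1 hα).2] with v hv
      simpa using (ne_of_gt hv)
  have hquotβ : Tendsto (fun v => ((β v : ℝ) : ℂ)⁻¹ * c (β v)) (𝓝[>] 0) (𝓝 1) :=
    hquot.comp (tendsto_nhdsWithin_iff.2 ⟨(tendsto_nhdsWithin_iff.1 hβ).1, by
      filter_upwards [(tendsto_nhdsWithin_iff.1 hβ).2] with v hv using (ne_of_gt hv)⟩)
  have harg : ∀ {f : ℝ → ℂ}, Tendsto f (𝓝[>] 0) (𝓝 1) →
      Tendsto (fun v => (((f v).arg : ℝ) : ℂ)) (𝓝[>] 0) (𝓝 0) := by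
    intro f hf
    have := (Complex.continuousAt_arg Complex.one_mem_slitPlane).tendsto.comp hf
    have h2 := (Complex.continuous_ofReal.tendsto _).comp this
    simpa [Function.comp_def] using h2
  -- The ends are equidistant from `0`, so the real parts of the logarithms cancel; the arguments
  -- tend to `0` because the tangent is `1`.
  have hends : Tendsto (fun v => Complex.log (-c (-α v)) - Complex.log (c (β v))) (𝓝[>] 0)
      (𝓝 0) := by
    have := ((harg hquotα).sub (harg hquotβ)).mul_const Complex.I
    rw [sub_zero, zero_mul] at this
    refine this.congr' ?_
    filter_upwards [(tendsto_nhdsWithin_iff.1 hα).2, (tendsto_nhdsWithin_iff.1 hβ).2, hαβ]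
      with v hav hbv hv
    rw [mem_Ioi] at hav hbv
    have ea : ((-α v : ℝ) : ℂ)⁻¹ * c (-α v) = ((α v)⁻¹ : ℝ) * -c (-α v) := by
      push_cast
      rw [inv_neg]
      ring
    have eb : ((β v : ℝ) : ℂ)⁻¹ * c (β v) = ((β v)⁻¹ : ℝ) * c (β v) := by push_cast; ring
    rw [ea, eb, Complex.arg_real_mul _ (inv_pos.2 hav), Complex.arg_real_mul _ (inv_pos.2 hbv)]
    rw [Complex.log, Complex.log, norm_neg, hv]
    ring
  have hfin := hends.const_add (Real.pi * Complex.I)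
  rw [add_zero] at hfin
  refine hfin.congr' ?_
  filter_upwards [hα (Ioo_mem_nhdsGT hδ0), hβ (Ioo_mem_nhdsGT hδ0)] with v hav hbv
  have hav' : α v ∈ Ioo 0 δ := hav
  have hbv' : β v ∈ Ioo 0 δ := hbv
  have i1 : ∫ s in (β v)..δ, deriv c s / c s = Complex.log (c δ) - Complex.log (c (β v)) :=
    integral_deriv_div_eq_log_sub hdiff hcd hbv'.2.le fun s hs =>
      Or.inl (hrp s ⟨hbv'.1.trans_le hs.1, hs.2⟩)
  have i2 : ∫ s in (1 - δ)..(1 - α v), deriv c s / c s =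
      Complex.log (-c (-α v)) - Complex.log (-c (-δ)) := by
    rw [← integral_deriv_div_eq_log_sub (f := fun s => -c s) (fun s => (hdiff s).neg) hcd.neg
      (by linarith [hav'.2] : -δ ≤ -α v) fun s hs =>
      Or.inl (hrn s ⟨hs.1, by linarith [hs.2, hav'.1]⟩)]
    have := intervalIntegral.integral_comp_add_right (a := -δ) (b := -α v)
      (fun s => deriv c s / c s) 1
    rw [show -δ + 1 = 1 - δ by ring, show -α v + 1 = 1 - α v by ring] at this
    rw [← this]
    congr 1
    ext s
    simp only [hper s, hperd s, neg_div_neg_eq]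
  have hint : ∀ a b, 0 < a → a ≤ b → b < 1 →
      IntervalIntegrable (fun s => deriv c s / c s) volume a b := by
    intro a b ha hab hb
    refine ContinuousOn.intervalIntegrable ?_
    rw [uIcc_of_le hab]
    exact hcd.continuousOn.div hcc.continuousOn fun s hs =>
      hne s ⟨ha.trans_le hs.1, hs.2.trans_lt hb⟩
  rw [← intervalIntegral.integral_add_adjacent_intervals (b := 1 - δ)
    (hint _ _ hbv'.1 (by linarith [hbv'.2]) (by linarith))
    (hint _ _ (by linarith) (by linarith [hav'.2]) (by linarith [hav'.1])),
    ← intervalIntegral.integral_add_adjacent_intervals (b := δ)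
    (hint _ _ hbv'.1 hbv'.2.le (by linarith)) (hint _ _ hδ0 (by linarith) (by linarith)), i1, i2]
  linear_combination -hPV

/-- The principal value of `∫ dτ / (τ - t)` over the contour is `π i`. -/
theorem IsSmoothContour.tendsto_principalValue {p : ℕ} {γ : ℝ → ℂ} (hγ : IsSmoothContour p γ)
    (hp : 1 ≤ p) (s₀ : ℝ)
    {α β : ℝ → ℝ} (hα : Tendsto α (𝓝[>] 0) (𝓝[>] 0)) (hβ : Tendsto β (𝓝[>] 0) (𝓝[>] 0))
    (hαβ : ∀ᶠ v in 𝓝[>] (0 : ℝ), ‖γ (s₀ - α v) - γ s₀‖ = ‖γ (s₀ + β v) - γ s₀‖) :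
    Tendsto (fun v => ∫ s in (s₀ + β v)..(s₀ + 1 - α v), deriv γ s / (γ s - γ s₀)) (𝓝[>] 0)
      (𝓝 (Real.pi * Complex.I)) := by
  have h1 := hγ.contDiff_one hp
  have hdiff : ∀ s, HasDerivAt γ (deriv γ s) s := fun s =>
    (h1.differentiable one_ne_zero s).hasDerivAt
  set u := deriv γ s₀ with hu
  have hu0 : u ≠ 0 := hγ.deriv_ne_zero s₀
  -- The form `dτ / (τ - t)` is invariant under affine maps, so the point may be put at `0` with
  -- tangent `1`.
  set c : ℝ → ℂ := fun s => (γ (s₀ + s) - γ s₀) / u with hcdef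
  have hcder : ∀ s, deriv c s = deriv γ (s₀ + s) / u := fun s =>
    ((((hdiff (s₀ + s)).comp_const_add s₀ s).sub_const (γ s₀)).div_const u).deriv
  have hquot : ∀ s z, deriv c s / (c s - z) = deriv γ (s₀ + s) / (γ (s₀ + s) - (γ s₀ + u * z)) := by
    intro s z
    rw [hcder, show c s - z = (γ (s₀ + s) - (γ s₀ + u * z)) / u by
      simp only [hcdef]; field_simp; ring, div_div_div_cancel_right₀ hu0]
  have hper := periodic_deriv hγ.periodic
  refine (tendsto_principalValue_of_deriv_eq_one (c := c) ?_ ?_ ?_ ?_ ?_ ?_ hα hβ ?_).congr ?_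
  · exact ((h1.comp (contDiff_const.add contDiff_id)).sub contDiff_const).div_const u
  · intro s
    simp only [hcdef, ← add_assoc, hγ.periodic (s₀ + s)]
  · simp [hcdef]
  · rw [hcder, add_zero, div_self hu0]
  · exact fun s hs => div_ne_zero (sub_ne_zero.2 (hγ.add_ne s₀ hs)) hu0
  · intro z hz
    have hz' : γ s₀ + u * z ∉ range γ := by
      rintro ⟨s, hs⟩
      refine hz ⟨s - s₀, ?_⟩
      simp only [hcdef, add_sub_cancel, hs]
      field_simp
      ring
    have hP : Function.Periodic (fun s => deriv γ s / (γ s - (γ s₀ + u * z))) 1 := fun s => by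
      simp only [hγ.periodic s, hper s]
    have e1 : ∫ s in (0 : ℝ)..1, deriv c s / (c s - z) =
        ∫ s in (0 : ℝ)..1, deriv γ s / (γ s - (γ s₀ + u * z)) := by
      simp only [hquot]
      rw [intervalIntegral.integral_comp_add_left
        (fun s => deriv γ s / (γ s - (γ s₀ + u * z))) s₀, add_zero]
      have := hP.intervalIntegral_add_eq s₀ 0
      rwa [zero_add] at this
    rw [e1]
    by_cases hD : γ s₀ + u * z ∈ innerDomain γ
    · right
      have := hγ.positive _ hD
      rw [windingNumber, inv_mul_eq_one₀] at this
      · exact this.symm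
      · exact mul_ne_zero (by exact_mod_cast (mul_pos two_pos Real.pi_pos).ne') Complex.I_ne_zero
    · left
      exact integral_winding_eq_zero h1 hγ.periodic hz' hD
  · filter_upwards [hαβ] with v hv
    simp only [hcdef, norm_div, ← sub_eq_add_neg, hv]
  · intro v
    have h2 := fun s => hquot s 0
    simp only [sub_zero, mul_zero, add_zero] at h2
    simp only [h2]
    rw [intervalIntegral.integral_comp_add_left
        (fun s => deriv γ s / (γ s - γ s₀)) s₀]
    congr 1
    ring

/-! ### Peano expansions and the angular part of an arc. -/

open Polynomial Asymptotics

/-- `f` has a Peano (Taylor) expansion of order `m` at `0`. -/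
def HasPeano (m : ℕ) (f : ℝ → ℂ) : Prop :=
  ∃ P : ℂ[X], (fun s : ℝ => f s - P.eval (s : ℂ)) =o[𝓝[≠] (0 : ℝ)] fun s : ℝ => s ^ m

namespace HasPeano

variable {m : ℕ} {f g : ℝ → ℂ}

theorem tendsto_eval (P : ℂ[X]) :
    Tendsto (fun s : ℝ => P.eval (s : ℂ)) (𝓝[≠] 0) (𝓝 (P.eval 0)) := by
  have : Continuous fun s : ℝ => P.eval (s : ℂ) := P.continuous.comp Complex.continuous_ofReal
  simpa using (this.tendsto 0).mono_left nhdsWithin_le_nhds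

theorem pow_isBigO {k m : ℕ} (h : k ≤ m) :
    (fun s : ℝ => s ^ m) =O[𝓝[≠] (0 : ℝ)] fun s : ℝ => s ^ k := by
  obtain ⟨d, rfl⟩ := Nat.exists_eq_add_of_le h
  have : (fun s : ℝ => s ^ d) =O[𝓝[≠] (0 : ℝ)] fun _ => (1 : ℝ) :=
    (((continuous_pow d).tendsto 0).mono_left nhdsWithin_le_nhds).isBigO_one ℝ
  simpa [pow_add] using (isBigO_refl (fun s : ℝ => s ^ k) _).mul this

theorem mono {k : ℕ} (hf : HasPeano m f) (h : k ≤ m) : HasPeano k f := by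
  obtain ⟨P, hP⟩ := hf
  exact ⟨P, hP.trans_isBigO (pow_isBigO h)⟩

theorem congr (hf : HasPeano m f) (h : f =ᶠ[𝓝[≠] 0] g) : HasPeano m g := by
  obtain ⟨P, hP⟩ := hf
  refine ⟨P, hP.congr' ?_ EventuallyEq.rfl⟩
  filter_upwards [h] with s hs
  rw [hs]

theorem tendsto_of_isLittleO {P : ℂ[X]}
    (h : (fun s : ℝ => f s - P.eval (s : ℂ)) =o[𝓝[≠] (0 : ℝ)] fun s : ℝ => s ^ m) :
    Tendsto f (𝓝[≠] 0) (𝓝 (P.eval 0)) := by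
  have h0 : Tendsto (fun s : ℝ => f s - P.eval (s : ℂ)) (𝓝[≠] 0) (𝓝 0) := by
    have := h.trans_isBigO (pow_isBigO (Nat.zero_le m))
    simpa [isLittleO_one_iff] using this
  simpa using h0.add (tendsto_eval P)

theorem const (m : ℕ) (a : ℂ) : HasPeano m fun _ => a := ⟨C a, by simp⟩

theorem add (hf : HasPeano m f) (hg : HasPeano m g) : HasPeano m fun s => f s + g s := by
  obtain ⟨P, hP⟩ := hf
  obtain ⟨Q, hQ⟩ := hg
  refine ⟨P + Q, (hP.add hQ).congr_left fun s => ?_⟩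
  rw [eval_add]
  ring

/-- The degree of the polynomial is not bounded in `HasPeano`, so `P * Q` serves without truncation.
-/
theorem mul (hf : HasPeano m f) (hg : HasPeano m g) : HasPeano m fun s => f s * g s := by
  obtain ⟨P, hP⟩ := hf
  obtain ⟨Q, hQ⟩ := hg
  refine ⟨P * Q, ?_⟩
  have h1 := hP.mul_isBigO ((tendsto_of_isLittleO hQ).isBigO_one ℝ)
  have h2 := ((tendsto_eval P).isBigO_one ℝ).mul_isLittleO hQ
  simp only [one_mul, mul_one] at h1 h2
  refine (h1.add h2).congr_left fun s => ?_
  rw [eval_mul]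
  ring

theorem pow (hf : HasPeano m f) (n : ℕ) : HasPeano m fun s => f s ^ n := by
  induction n with
  | zero => simpa using const m 1
  | succ n ih => simpa only [pow_succ] using ih.mul hf

theorem eval (hf : HasPeano m f) (T : ℂ[X]) : HasPeano m fun s => T.eval (f s) := by
  induction T using Polynomial.induction_on' with
  | add P Q hP hQ => simpa only [eval_add] using hP.add hQ
  | monomial n a => simpa only [eval_monomial] using (const m a).mul (hf.pow n)

theorem conj (hf : HasPeano m f) : HasPeano m fun s => (starRingEnd ℂ) (f s) := by
  obtain ⟨P, hP⟩ := hf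
  refine ⟨P.map (starRingEnd ℂ), ?_⟩
  refine (isLittleO_norm_left.1 (hP.norm_left.congr_left fun s => ?_))
  have : (P.map (starRingEnd ℂ)).eval (s : ℂ) = (starRingEnd ℂ) (P.eval (s : ℂ)) := by
    have := eval_map_apply (p := P) (starRingEnd ℂ) (s : ℂ)
    rwa [Complex.conj_ofReal] at this
  rw [this, ← map_sub, RCLike.norm_conj]

/-- The limit `a` must be `P.eval 0`, so `P - a` is divisible by the variable; the division costs
one order. -/
theorem div_var (hf : HasPeano (m + 1) f) {a : ℂ} (ha : Tendsto f (𝓝[≠] 0) (𝓝 a)) :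
    HasPeano m fun s => (f s - a) / s := by
  obtain ⟨P, hP⟩ := hf
  have hPa : P.eval 0 = a := tendsto_nhds_unique (tendsto_of_isLittleO hP) ha
  refine ⟨P.divX, ?_⟩
  have h1 : (fun s : ℝ => (s : ℂ)⁻¹) =O[𝓝[≠] (0 : ℝ)] fun s : ℝ => s⁻¹ :=
    IsBigO.of_bound 1 (Eventually.of_forall fun s => by simp)
  refine (h1.mul_isLittleO hP).congr' ?_ ?_
  · filter_upwards [self_mem_nhdsWithin] with s hs
    have hs' : (s : ℂ) ≠ 0 := by exact_mod_cast hs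
    have h2 := congrArg (Polynomial.eval (s : ℂ)) (X_mul_divX_add P)
    rw [eval_add, eval_mul, eval_X, eval_C, coeff_zero_eq_eval_zero, hPa] at h2
    rw [← h2]
    field_simp
    ring
  · filter_upwards [self_mem_nhdsWithin] with s hs
    have hs' : s ≠ 0 := hs
    rw [pow_succ', inv_mul_cancel_left₀ hs']

/-- For `m ≥ 1` one has `f - a = O(s)`, so the Taylor remainder `O(‖f - a‖^(m+1))` of `φ` is
`o(s^m)`; what remains is a polynomial in `f`. -/
theorem comp_analyticAt (hf : HasPeano m f) {φ : ℂ → ℂ} {a : ℂ} (hφ : AnalyticAt ℂ φ a)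
    (ha : Tendsto f (𝓝[≠] 0) (𝓝 a)) : HasPeano m fun s => φ (f s) := by
  obtain ⟨p, hp⟩ := hφ
  set T : ℂ[X] := ∑ k ∈ Finset.range (m + 1), Polynomial.C (p.coeff k) * X ^ k
  have hT : ∀ y, p.partialSum (m + 1) y = T.eval y := fun y => by
    simp only [FormalMultilinearSeries.partialSum, T, eval_finsetSum, eval_mul, eval_C, eval_pow,
      eval_X, FormalMultilinearSeries.apply_eq_pow_smul_coeff, smul_eq_mul, mul_comm]
  have hy : Tendsto (fun s => f s - a) (𝓝[≠] 0) (𝓝 0) := by simpa using ha.sub_const a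
  have h1 := (hp.isBigO_sub_partialSum_pow (m + 1)).comp_tendsto hy
  have h2 : (fun s => ‖f s - a‖ ^ m) =O[𝓝[≠] (0 : ℝ)] fun s : ℝ => s ^ m := by
    rcases Nat.eq_zero_or_pos m with rfl | hm
    · simpa only [pow_zero] using isBigO_refl (fun _ : ℝ => (1 : ℝ)) _
    · refine IsBigO.pow ?_ m
      obtain ⟨d, hd⟩ := (hf.mono hm).div_var ha
      have h3 := ((tendsto_of_isLittleO hd).isBigO_one ℝ).mul
        (IsBigO.of_bound 1 (Eventually.of_forall fun s : ℝ => by simp) :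
          (fun s : ℝ => (s : ℂ)) =O[𝓝[≠] (0 : ℝ)] fun s : ℝ => s)
      refine (h3.norm_left.congr' ?_ (by simp))
      filter_upwards [self_mem_nhdsWithin] with s hs
      have hs' : (s : ℂ) ≠ 0 := by exact_mod_cast hs
      rw [div_mul_cancel₀ _ hs']
  have h4 : (fun s => φ (f s) - T.eval (f s - a)) =o[𝓝[≠] (0 : ℝ)] fun s : ℝ => s ^ m := by
    have h5 : (fun s => ‖f s - a‖) =o[𝓝[≠] (0 : ℝ)] fun _ => (1 : ℝ) :=
      (isLittleO_one_iff ℝ).2 (by simpa using hy.norm)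
    have h6 := h2.mul_isLittleO h5
    simp only [mul_one, ← pow_succ] at h6
    refine (h1.trans_isLittleO h6).congr_left fun s => ?_
    simp [hT]
  obtain ⟨Q, hQ⟩ := ((hf.add (const m (-a))).eval T)
  refine ⟨Q, (h4.add hQ).congr_left fun s => ?_⟩
  simp [sub_eq_add_neg]

theorem of_contDiff (hf : ContDiff ℝ m f) : HasPeano m f := by
  refine ⟨∑ k ∈ Finset.range (m + 1), Polynomial.C ((Nat.factorial k : ℂ)⁻¹ *
    iteratedDerivWithin k f univ 0) * X ^ k, ?_⟩
  have h := (taylor_isLittleO_univ (x₀ := 0) hf).mono (nhdsWithin_le_nhds (s := {0}ᶜ))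
  simp only [sub_zero] at h
  refine h.congr_left fun s => ?_
  rw [taylor_within_apply, eval_finsetSum]
  congr 1
  refine Finset.sum_congr rfl fun k _ => ?_
  simp only [sub_zero, Complex.real_smul, eval_mul, eval_C, eval_pow, eval_X]
  push_cast
  ring

/-- A Peano expansion in `s` can be rewritten as one in a new variable `s * κ s`. -/
theorem exists_eval_mul {κ : ℝ → ℂ} {κ₀ : ℂ} (h0 : κ₀ ≠ 0) (hκ : Tendsto κ (𝓝[≠] 0) (𝓝 κ₀)) :
    ∀ {m : ℕ} {F : ℝ → ℂ}, HasPeano m κ → HasPeano m F → ∃ W : ℂ[X], W.natDegree ≤ m ∧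
      (fun s : ℝ => F s - W.eval (s * κ s)) =o[𝓝[≠] (0 : ℝ)] fun s : ℝ => s ^ m
  | 0, F, _, hF => by
    obtain ⟨P, hP⟩ := hF
    refine ⟨Polynomial.C (P.eval 0), by simp, ?_⟩
    have := tendsto_of_isLittleO hP
    simp only [eval_C, pow_zero, isLittleO_one_iff]
    simpa using this.sub_const (P.eval 0)
  | m + 1, F, hk, hF => by
    obtain ⟨P, hP⟩ := id hF
    have hPa := tendsto_of_isLittleO hP
    -- Horner's scheme: `F = P(0) + (s κ) * ((F - P(0)) / (s κ))`, where the last quotient has an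
    -- expansion of order `m` and is expanded recursively.
    have hinv : HasPeano m fun s => (κ s)⁻¹ :=
      (hk.mono m.le_succ).comp_analyticAt (analyticAt_inv h0) hκ
    obtain ⟨W, hW, hWF⟩ := exists_eval_mul h0 hκ (hk.mono m.le_succ) ((hF.div_var hPa).mul hinv)
    refine ⟨Polynomial.C (P.eval 0) + X * W, ?_, ?_⟩
    · refine (natDegree_add_le _ _).trans (max_le (by simp) ?_)
      refine natDegree_mul_le.trans ?_
      rw [natDegree_X]
      omega
    · have h1 : (fun s : ℝ => (s : ℂ) * κ s) =O[𝓝[≠] (0 : ℝ)] fun s : ℝ => s := by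
        have := (IsBigO.of_bound 1 (Eventually.of_forall fun s : ℝ => by simp) :
          (fun s : ℝ => (s : ℂ)) =O[𝓝[≠] (0 : ℝ)] fun s : ℝ => s).mul (hκ.isBigO_one ℝ)
        simpa using this
      refine (h1.mul_isLittleO hWF).congr' ?_ (by simp [pow_succ'])
      filter_upwards [self_mem_nhdsWithin, hκ.eventually (isOpen_ne.mem_nhds h0)] with s hs hks
      have hs' : (s : ℂ) ≠ 0 := by exact_mod_cast hs
      have hks' : κ s ≠ 0 := hks
      simp only [eval_add, eval_mul, eval_C, eval_X]
      field_simp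
      ring

end HasPeano

/-- The angular part of a regular arc has a Peano expansion in the signed chord length. -/
theorem exists_angular_expansion {c : ℝ → ℂ} {n : ℕ} (hc : ContDiff ℝ (n + 1 : ℕ) c) (h0 : c 0 = 0)
    (h1 : deriv c 0 ≠ 0) : ∃ W : ℂ[X], W.natDegree ≤ n ∧
      (fun s : ℝ => ((s * ‖c s / s‖ : ℂ) / c s) ^ n - W.eval (s * ‖c s / s‖ : ℂ))
        =o[𝓝[≠] (0 : ℝ)] fun s : ℝ => s ^ n := by
  have hdiff : HasDerivAt c (deriv c 0) 0 :=
    (hc.differentiable (by simp) 0).hasDerivAt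
  have hlim : Tendsto (fun s : ℝ => c s / s) (𝓝[≠] 0) (𝓝 (deriv c 0)) := by
    have := hasDerivAt_iff_tendsto_slope_zero.1 hdiff
    simpa [h0, div_eq_inv_mul] using this
  have hc0 : Tendsto c (𝓝[≠] 0) (𝓝 0) := by
    have := (hc.continuous.tendsto 0).mono_left (nhdsWithin_le_nhds (s := {0}ᶜ))
    rwa [h0] at this
  have hh : HasPeano n fun s => c s / s := by
    simpa using (HasPeano.of_contDiff hc).div_var hc0
  have hne : ∀ᶠ s : ℝ in 𝓝[≠] 0, c s / s ≠ 0 := hlim.eventually (isOpen_ne.mem_nhds h1)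
  have hκlim : Tendsto (fun s : ℝ => ((‖c s / s‖ : ℝ) : ℂ)) (𝓝[≠] 0) (𝓝 ‖deriv c 0‖) :=
    (Complex.continuous_ofReal.tendsto _).comp hlim.norm
  have hN : Tendsto (fun s : ℝ => c s / s * (starRingEnd ℂ) (c s / s)) (𝓝[≠] 0)
      (𝓝 (deriv c 0 * (starRingEnd ℂ) (deriv c 0))) :=
    hlim.mul ((Complex.continuous_conj.tendsto _).comp hlim)
  have hκ0 : ((‖deriv c 0‖ : ℝ) : ℂ) ≠ 0 := by simpa using h1
  have hκ : HasPeano n fun s => ((‖c s / s‖ : ℝ) : ℂ) := by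
    -- The modulus is not analytic, but it equals `exp (log (h * conj h) / 2)`, analytic in the
    -- product `h * conj h`, whose limit is a positive real.
    have hφ : AnalyticAt ℂ (fun z => Complex.exp (Complex.log z / 2))
        (deriv c 0 * (starRingEnd ℂ) (deriv c 0)) := by
      refine ((AnalyticAt.clog analyticAt_id ?_).div analyticAt_const two_ne_zero).cexp
      rw [id, Complex.mul_conj, Complex.ofReal_mem_slitPlane]
      exact Complex.normSq_pos.2 h1
    refine ((hh.mul hh.conj).comp_analyticAt hφ hN).congr ?_
    filter_upwards [hne] with s hs
    rw [Complex.mul_conj, Complex.normSq_eq_norm_sq, ← Complex.ofReal_log (by positivity),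
      Real.log_pow]
    push_cast
    rw [mul_div_cancel_left₀ _ (two_ne_zero' ℂ), ← Complex.ofReal_exp,
      Real.exp_log (norm_pos_iff.2 hs)]
  have hF := (hκ.mul (hh.comp_analyticAt (analyticAt_inv h1) hlim)).pow n
  obtain ⟨W, hW, hWF⟩ := HasPeano.exists_eval_mul hκ0 hκlim hκ hF
  refine ⟨W, hW, hWF.congr' ?_ EventuallyEq.rfl⟩
  filter_upwards [self_mem_nhdsWithin, hne] with s hs hs2
  have hs' : (s : ℂ) ≠ 0 := by exact_mod_cast hs
  have hcs : c s ≠ 0 := fun h => hs2 (by simp [h])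
  congr 2
  rw [inv_div]
  ring

/-! ### Uniqueness of the finite part. -/

/-- A function `η(v) / v^m` with `deg η < m` has no finite nonzero limit at `0+`. -/
theorem eq_zero_of_tendsto_eval_div_pow {η : ℂ[X]} {m : ℕ} (hη : η ∈ degreeLT ℂ m) {c : ℂ}
    (h : Tendsto (fun v : ℝ => η.eval (v : ℂ) / (v : ℂ) ^ m) (𝓝[>] 0) (𝓝 c)) : c = 0 := by
  by_contra hc
  set q : ℂ[X] := η - C c * X ^ m with hq
  have hcoeff : q.coeff m = -c := by
    have : η.coeff m = 0 := coeff_eq_zero_of_degree_lt (mem_degreeLT.1 hη)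
    simp [hq, this]
  have hq0 : q ≠ 0 := fun h0 => hc (by simpa [h0] using hcoeff.symm)
  have hqdeg : q.natDegree ≤ m := by
    refine (natDegree_sub_le _ _).trans (max_le ?_ (natDegree_C_mul_X_pow_le _ _))
    exact natDegree_le_iff_degree_le.2 (mem_degreeLT.1 hη).le
  -- Write `q = X^j * r` with `r(0) ≠ 0` and `j ≤ m`. Then `r(v) = (η(v) / v^m - c) * v^(m-j)` tends
  -- to `0`, a contradiction.
  obtain ⟨r, hr, hdvd⟩ := q.exists_eq_pow_rootMultiplicity_mul_and_not_dvd hq0 0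
  set j := q.rootMultiplicity 0
  rw [dvd_iff_isRoot, IsRoot] at hdvd
  rw [C_0, sub_zero] at hr
  have hr0 : r ≠ 0 := fun h0 => hdvd (by simp [h0])
  have hj : j ≤ m := by
    have := congrArg natDegree hr
    rw [natDegree_mul (pow_ne_zero _ X_ne_zero) hr0, natDegree_X_pow] at this
    omega
  have hv0 : ∀ᶠ v : ℝ in 𝓝[>] 0, (v : ℂ) ≠ 0 := by
    filter_upwards [self_mem_nhdsWithin] with v hv
    exact_mod_cast (ne_of_gt hv)
  have h1 : Tendsto (fun v : ℝ => η.eval (v : ℂ) / (v : ℂ) ^ m - c) (𝓝[>] 0) (𝓝 0) := by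
    simpa using h.sub_const c
  have hpow : (fun v : ℝ => (v : ℂ) ^ (m - j)) =O[𝓝[>] (0 : ℝ)] fun _ => (1 : ℝ) := by
    have : Continuous fun v : ℝ => (v : ℂ) ^ (m - j) := by fun_prop
    exact ((this.tendsto 0).mono_left nhdsWithin_le_nhds).isBigO_one ℝ
  have h2 : Tendsto (fun v : ℝ => r.eval (v : ℂ)) (𝓝[>] 0) (𝓝 0) := by
    have := ((isLittleO_one_iff ℝ).2 h1).mul_isBigO hpow
    rw [mul_one, isLittleO_one_iff] at this
    refine this.congr' ?_
    filter_upwards [hv0] with v hv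
    have h3 := congrArg (Polynomial.eval (v : ℂ)) hr
    rw [hq, eval_sub, eval_mul, eval_C, eval_pow, eval_X, eval_mul, eval_pow, eval_X] at h3
    have h4 : (v : ℂ) ^ m = (v : ℂ) ^ j * (v : ℂ) ^ (m - j) := by rw [← pow_add]; congr 1; omega
    have h5 := pow_ne_zero j hv
    have h6 := pow_ne_zero (m - j) hv
    rw [h4] at h3 ⊢
    field_simp
    linear_combination h3
  have h3 : Tendsto (fun v : ℝ => r.eval (v : ℂ)) (𝓝[>] 0) (𝓝 (r.eval 0)) := by
    have : Continuous fun v : ℝ => r.eval (v : ℂ) := r.continuous.comp Complex.continuous_ofReal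
    simpa using (this.tendsto 0).mono_left nhdsWithin_le_nhds
  exact hdvd (tendsto_nhds_unique h3 h2)

theorem HasHypersingularIntegral.unique {γ : ℝ → ℂ} {φ : ℂ → ℂ} {k : ℕ} {t I J : ℂ}
    (hI : HasHypersingularIntegral γ φ k t I) (hJ : HasHypersingularIntegral γ φ k t J) :
    I = J := by
  obtain ⟨-, ξ, hξ, h1⟩ := hI
  obtain ⟨-, ζ, hζ, h2⟩ := hJ
  have := eq_zero_of_tendsto_eval_div_pow (Submodule.sub_mem _ hξ hζ) (c := I - J)
    ((h1.sub h2).congr fun v => by rw [eval_sub]; ring)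
  exact sub_eq_zero.1 this

/-! ### Hadamard integrals of the constant function. -/

section Contour

variable {p : ℕ} {γ : ℝ → ℂ}

theorem measurableSet_cutParam (hγ : Continuous γ) (t : ℂ) (v : ℝ) :
    MeasurableSet (cutParam γ t v) :=
  measurableSet_Ico.inter
    (isOpen_lt continuous_const (by fun_prop : Continuous fun s => ‖γ s - t‖)).measurableSet

theorem sub_ne_zero_of_mem_cutParam {t : ℂ} {v : ℝ} (hv : 0 < v) {s : ℝ}
    (hs : s ∈ cutParam γ t v) : γ s - t ≠ 0 :=
  norm_pos_iff.1 (hv.trans hs.2)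

theorem integrableOn_kernel (hγ : ContDiff ℝ 1 γ) {φ : ℂ → ℂ} (hφ : ContinuousOn φ (range γ))
    (k : ℕ) (t : ℂ) {v : ℝ} (hv : 0 < v) : IntegrableOn (kernel γ φ k t) (cutParam γ t v) := by
  have hγc : Continuous γ := hγ.continuous
  set S : Set ℝ := Icc 0 1 ∩ {s | v ≤ ‖γ s - t‖}
  have hS : IsCompact S := isCompact_Icc.inter_right
    (isClosed_le continuous_const (by fun_prop : Continuous fun s => ‖γ s - t‖))
  refine (ContinuousOn.integrableOn_compact hS ?_).mono_set
    (t := S) fun s hs => ⟨Ico_subset_Icc_self hs.1, hs.2.le⟩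
  have h1 : Continuous fun s => φ (γ s) := hφ.comp_continuous hγc fun s => ⟨s, rfl⟩
  refine (h1.continuousOn.div (by fun_prop) fun s hs => pow_ne_zero k ?_).mul
    (hγ.continuous_deriv le_rfl).continuousOn
  exact norm_pos_iff.1 (hv.trans_le hs.2)

theorem periodic_kernel (hγ : Function.Periodic γ 1) (φ : ℂ → ℂ) (k : ℕ) (t : ℂ) :
    Function.Periodic (kernel γ φ k t) 1 := fun s => by
  simp only [kernel, hγ s, periodic_deriv hγ s]

/-- The cut integrals of a continuous integrand tend to the integral over the contour. -/
theorem IsSmoothContour.tendsto_integral_cutParam (hγ : IsSmoothContour p γ) (hp : 1 ≤ p) (s₀ : ℝ)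
    {F : ℝ → ℂ} (hF : Continuous F) (hper : Function.Periodic F 1) :
    Tendsto (fun v => ∫ s in cutParam γ (γ s₀) v, F s) (𝓝[>] 0)
      (𝓝 (∫ s in (0 : ℝ)..1, F s)) := by
  obtain ⟨α, β, hα, hβ, hcut⟩ := hγ.exists_cut hp s₀
  have hα' := (tendsto_nhdsWithin_iff.1 hα).1
  have hβ' := (tendsto_nhdsWithin_iff.1 hβ).1
  have hprim : Continuous fun b => ∫ s in (0 : ℝ)..b, F s :=
    intervalIntegral.continuous_primitive (fun a b => hF.intervalIntegrable a b) 0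
  have h1 := (hprim.tendsto (s₀ + 1 - 0)).comp (hα'.const_sub (s₀ + 1))
  have h2 := (hprim.tendsto (s₀ + 0)).comp (hβ'.const_add s₀)
  have h3 := h1.sub h2
  have e : ∀ a b, (∫ s in (0 : ℝ)..b, F s) - ∫ s in (0 : ℝ)..a, F s = ∫ s in a..b, F s :=
    fun a b => intervalIntegral.integral_interval_sub_left (hF.intervalIntegrable _ _)
      (hF.intervalIntegrable _ _)
  simp only [Function.comp_def, e, sub_zero, add_zero] at h3
  rw [hper.intervalIntegral_add_eq s₀ 0, zero_add] at h3
  refine h3.congr' ?_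
  filter_upwards [hcut] with v hv
  exact (hv.2.2.2.2 F hper).symm

/-- The Cauchy principal value of `∫ dτ / (τ - t)`. -/
theorem IsSmoothContour.hasHypersingularIntegral_one (hγ : IsSmoothContour p γ) (hp : 1 ≤ p)
    (s₀ : ℝ) :
    HasHypersingularIntegral γ (fun _ => 1) 1 (γ s₀) (Real.pi * Complex.I) := by
  refine ⟨?_, 0, Submodule.zero_mem _, ?_⟩
  · filter_upwards [self_mem_nhdsWithin] with v hv
    exact integrableOn_kernel (hγ.contDiff_one hp) continuousOn_const _ _ hv
  obtain ⟨α, β, hα, hβ, hcut⟩ := hγ.exists_cut hp s₀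
  refine (hγ.tendsto_principalValue hp s₀ hα hβ ?_).congr' ?_
  · filter_upwards [hcut] with v hv
    rw [hv.2.2.1, hv.2.2.2.1]
  · filter_upwards [hcut] with v hv
    rw [hv.2.2.2.2 _ (periodic_kernel hγ.periodic _ _ _), eval_zero, zero_div, add_zero]
    congr 1
    ext s
    simp only [kernel, pow_one]
    ring

/-- The Hadamard finite part of `∫ dτ / (τ - t)^(n+1)` vanishes for `n ≥ 1`. -/
theorem IsSmoothContour.hasHypersingularIntegral_one_succ (hγ : IsSmoothContour p γ) {n : ℕ}
    (hn : 1 ≤ n) (hnp : n + 1 ≤ p) (s₀ : ℝ) :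
    HasHypersingularIntegral γ (fun _ => 1) (n + 1) (γ s₀) 0 := by
  have hp : 1 ≤ p := by omega
  have hC := hγ.contDiff_one hp
  have hγc : Continuous γ := hC.continuous
  have hcd : Continuous (deriv γ) := hC.continuous_deriv le_rfl
  have hdiff : ∀ s, HasDerivAt γ (deriv γ s) s := fun s =>
    (hC.differentiable one_ne_zero s).hasDerivAt
  have hn0 : (n : ℂ) ≠ 0 := by exact_mod_cast (by omega : n ≠ 0)
  obtain ⟨α, β, hα, hβ, hcut⟩ := hγ.exists_cut hp s₀
  set c : ℝ → ℂ := fun s => γ (s₀ + s) - γ s₀ with hc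
  have hcC : ContDiff ℝ (n + 1 : ℕ) c :=
    ((hγ.contDiff.of_le (by exact_mod_cast hnp)).comp (contDiff_const.add contDiff_id)).sub
      contDiff_const
  have hc' : deriv c 0 = deriv γ (s₀ + 0) :=
    (((hdiff (s₀ + 0)).comp_const_add s₀ 0).sub_const (γ s₀)).deriv
  have hc1 : deriv c 0 ≠ 0 := by
    rw [hc']
    exact hγ.deriv_ne_zero _
  have hc0 : c 0 = 0 := by simp [hc]
  obtain ⟨W, hW, hWF⟩ := exists_angular_expansion hcC hc0 hc1
  have hlim : Tendsto (fun s : ℝ => ‖c s / s‖) (𝓝[≠] 0) (𝓝 ‖deriv c 0‖) := by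
    have := hasDerivAt_iff_tendsto_slope_zero.1
      (hcC.differentiable (by simp) 0).hasDerivAt
    simpa [hc0, div_eq_inv_mul] using this.norm
  have hbig : (fun s : ℝ => s) =O[𝓝[≠] (0 : ℝ)] fun s : ℝ => s * ‖c s / s‖ := by
    have h1 := (hlim.inv₀ (norm_ne_zero_iff.2 hc1)).isBigO_one ℝ
    have h2 := (isBigO_refl (fun s : ℝ => s * ‖c s / s‖) (𝓝[≠] (0 : ℝ))).mul h1
    refine h2.congr' ?_ (by simp)
    filter_upwards [hlim.eventually (isOpen_ne.mem_nhds (norm_ne_zero_iff.2 hc1))] with s hs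
    rw [mul_assoc, mul_inv_cancel₀ hs, mul_one]
  -- Here `σ` is the sign of the end: the signed chord is `v` at the forward end and `-v` at the
  -- backward end. By `hbig` an error small in the parameter is small in `v`.
  have hend : ∀ (ε : ℝ → ℝ) (σ : ℝ), Tendsto ε (𝓝[>] 0) (𝓝[≠] 0) →
      (∀ᶠ v in 𝓝[>] (0 : ℝ), ε v * ‖c (ε v) / ε v‖ = σ * v) →
      Tendsto (fun v : ℝ => (((σ * v : ℂ) / c (ε v)) ^ n - W.eval (σ * v : ℂ)) / (v : ℂ) ^ n)
        (𝓝[>] 0) (𝓝 0) := by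
    intro ε σ hε hv
    have h1 := hWF.comp_tendsto hε
    have h2 := (hbig.comp_tendsto hε).pow n
    have h3 := h1.trans_isBigO h2
    have h4 : (fun v : ℝ => (((σ * v : ℂ) / c (ε v)) ^ n - W.eval (σ * v : ℂ)))
        =o[𝓝[>] (0 : ℝ)] fun v : ℝ => (σ * v) ^ n := by
      refine h3.congr' ?_ ?_
      · filter_upwards [hv] with v hv
        have hv' : (ε v : ℂ) * ((‖c (ε v) / ε v‖ : ℝ) : ℂ) = σ * v := by exact_mod_cast hv
        simp only [Function.comp_apply, hv']
      · filter_upwards [hv] with v hv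
        simp only [Function.comp_apply, hv]
    have h5 : (fun v : ℝ => (σ * v) ^ n) =O[𝓝[>] (0 : ℝ)] fun v : ℝ => (v : ℂ) ^ n := by
      refine IsBigO.pow (IsBigO.of_bound |σ| (Eventually.of_forall fun v => ?_)) n
      simp
    exact (h4.trans_isBigO h5).tendsto_div_nhds_zero
  have hβ0 : ∀ᶠ v in 𝓝[>] (0 : ℝ), 0 < β v := (tendsto_nhdsWithin_iff.1 hβ).2
  have hα0 : ∀ᶠ v in 𝓝[>] (0 : ℝ), 0 < α v := (tendsto_nhdsWithin_iff.1 hα).2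
  have hB := hend β 1 (tendsto_nhdsWithin_iff.2 ⟨(tendsto_nhdsWithin_iff.1 hβ).1, by
      filter_upwards [hβ0] with v hv using hv.ne'⟩) (by
    filter_upwards [hcut, hβ0] with v hv hb
    rw [norm_div, Complex.norm_real, Real.norm_of_nonneg hb.le, mul_div_cancel₀ _ hb.ne', one_mul]
    exact hv.2.2.2.1)
  have hA := hend (fun v => -α v) (-1) (tendsto_nhdsWithin_iff.2
      ⟨by simpa using (tendsto_nhdsWithin_iff.1 hα).1.neg, by
      filter_upwards [hα0] with v hv
      simpa using hv.ne'⟩) (by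
    filter_upwards [hcut, hα0] with v hv hb
    have h1 : ‖c (-α v)‖ = v := by
      simp only [hc, ← sub_eq_add_neg]
      exact hv.2.2.1
    rw [norm_div, Complex.norm_real, norm_neg, Real.norm_of_nonneg hb.le, h1]
    field_simp)
  -- The factor `1 - (-1)^(n + k)` vanishes at `k = n`: the top coefficient of `W` cancels between
  -- the two ends, leaving an admissible compensator and finite part `0`.
  set ξ : ℂ[X] := ∑ k ∈ Finset.range n, C (-(n : ℂ)⁻¹ * (W.coeff k * (1 - (-1) ^ (n + k)))) * X ^ k
    with hξ
  have hξdeg : ξ ∈ degreeLT ℂ n := by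
    refine Submodule.sum_mem _ fun k hk => mem_degreeLT.2 ?_
    refine (degree_C_mul_X_pow_le _ _).trans_lt ?_
    exact_mod_cast Finset.mem_range.1 hk
  have hξW : ∀ v : ℂ, ξ.eval v = -(n : ℂ)⁻¹ * (W.eval v - (-1) ^ n * W.eval (-v)) := by
    intro v
    rw [eval_eq_sum_range' (Nat.lt_succ_of_le hW) v, eval_eq_sum_range' (Nat.lt_succ_of_le hW) (-v),
      Finset.mul_sum, ← Finset.sum_sub_distrib, Finset.sum_range_succ, hξ, eval_finsetSum, mul_add,
      Finset.mul_sum]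
    have h1 : ((-1 : ℂ) ^ n) * (-v) ^ n = v ^ n := by rw [← mul_pow]; simp
    rw [show W.coeff n * v ^ n - (-1) ^ n * (W.coeff n * (-v) ^ n) = 0 by
      linear_combination -(W.coeff n) * h1, mul_zero, add_zero]
    refine Finset.sum_congr rfl fun k _ => ?_
    rw [neg_pow v k]
    simp only [eval_mul, eval_C, eval_pow, eval_X]
    ring
  refine ⟨?_, ξ, by simpa using hξdeg, ?_⟩
  · filter_upwards [self_mem_nhdsWithin] with v hv
    exact integrableOn_kernel hC continuousOn_const _ _ hv
  have hfin := (hB.sub (hA.const_mul ((-1 : ℂ) ^ n))).const_mul ((n : ℂ)⁻¹)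
  simp only [mul_zero, sub_zero] at hfin
  refine hfin.congr' ?_
  filter_upwards [hcut, hβ0, hα0, self_mem_nhdsWithin] with v hv hb ha hv0
  rw [mem_Ioi] at hv0
  have hvC : (v : ℂ) ≠ 0 := by exact_mod_cast hv0.ne'
  obtain ⟨ha2, hb2, hnα, hnβ, hint⟩ := hv
  have hcβ : c (β v) ≠ 0 := norm_pos_iff.1 (by simp only [hc]; rw [hnβ]; exact hv0)
  have hcα : c (-α v) ≠ 0 := norm_pos_iff.1 (by
    simp only [hc, ← sub_eq_add_neg]; rw [hnα]; exact hv0)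
  have hne : ∀ s ∈ Icc (s₀ + β v) (s₀ + 1 - α v), γ s - γ s₀ ≠ 0 := by
    intro s hs
    have := hγ.add_ne s₀ (s := s - s₀) ⟨by linarith [hs.1], by linarith [hs.2]⟩
    rw [add_sub_cancel] at this
    exact sub_ne_zero.2 this
  have hle : s₀ + β v ≤ s₀ + 1 - α v := by linarith
  have hJ : ∫ s in cutParam γ (γ s₀) v, kernel γ (fun _ => 1) (n + 1) (γ s₀) s =
      (n : ℂ)⁻¹ * ((c (β v) ^ n)⁻¹ - (c (-α v) ^ n)⁻¹) := by
    rw [hint _ (periodic_kernel hγ.periodic _ _ _)]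
    have hder : ∀ s ∈ uIcc (s₀ + β v) (s₀ + 1 - α v),
        HasDerivAt (fun s => -(n : ℂ)⁻¹ * ((γ s - γ s₀) ^ n)⁻¹)
          (kernel γ (fun _ => 1) (n + 1) (γ s₀) s) s := by
      intro s hs
      rw [uIcc_of_le hle] at hs
      have h0 := hne s hs
      have h1 := ((((hdiff s).sub_const (γ s₀)).fun_pow n).fun_inv (pow_ne_zero n h0)).const_mul
        (-(n : ℂ)⁻¹)
      refine h1.congr_deriv ?_
      obtain ⟨m, rfl⟩ : ∃ m, n = m + 1 := ⟨n - 1, by omega⟩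
      simp only [kernel, Nat.add_sub_cancel]
      field_simp
      ring
    rw [intervalIntegral.integral_eq_sub_of_hasDerivAt hder]
    · have e1 : γ (s₀ + 1 - α v) = γ (s₀ + -α v) := by
        rw [← hγ.periodic (s₀ + -α v)]
        congr 1
        ring
      simp only [hc, e1]
      ring
    · refine ContinuousOn.intervalIntegrable ?_
      rw [uIcc_of_le hle]
      exact (continuousOn_const.div (by fun_prop) fun s hs => pow_ne_zero _ (hne s hs)).mul
        hcd.continuousOn
  rw [hJ, hξW, Nat.add_sub_cancel]
  push_cast
  simp only [one_mul, neg_mul, div_pow, neg_pow (v : ℂ) n]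
  have h1 : ((-1 : ℂ) ^ n) * (-1) ^ n = 1 := by rw [← mul_pow]; simp
  field_simp
  linear_combination (-(c (β v)) ^ n * (v : ℂ) ^ n) * h1

end Contour

/-! ### Hadamard integrals of holomorphic functions. -/

/-- The Hadamard integral of a function holomorphic on the closed inner domain is `π i` times a
Taylor coefficient. -/
theorem IsSmoothContour.hasHypersingularIntegral {p : ℕ} {γ : ℝ → ℂ} (hγ : IsSmoothContour p γ)
    {U : Set ℂ} (hU : IsOpen U) (hLU : range γ ⊆ U) (hDU : innerDomain γ ⊆ U) (s₀ : ℝ) :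
    ∀ {m : ℕ} {x : ℂ → ℂ} {q : FormalMultilinearSeries ℂ ℂ ℂ}, m + 1 ≤ p →
      DifferentiableOn ℂ x U → HasFPowerSeriesAt x q (γ s₀) →
      HasHypersingularIntegral γ x (m + 1) (γ s₀) (Real.pi * Complex.I * q.coeff m) := by
  intro m
  induction m with
  | zero =>
    intro x q hp hx hq
    have hC := hγ.contDiff_one hp
    have hxt : q.coeff 0 = x (γ s₀) := hq.coeff_zero 1
    have hy : DifferentiableOn ℂ (dslope x (γ s₀)) U :=
      (Complex.differentiableOn_dslope (hU.mem_nhds (hLU ⟨s₀, rfl⟩))).2 hx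
    have hyc : Continuous fun s => dslope x (γ s₀) (γ s) * deriv γ s :=
      (hy.continuousOn.comp_continuous hC.continuous fun s => hLU ⟨s, rfl⟩).mul
        (hC.continuous_deriv le_rfl)
    obtain ⟨hi, ξ, hξ, h1⟩ := hγ.hasHypersingularIntegral_one hp s₀
    have h2 := hγ.tendsto_integral_cutParam hp s₀ hyc fun s => by
      simp only [hγ.periodic s, periodic_deriv hγ.periodic s]
    rw [integral_comp_mul_deriv_eq_zero hC hγ.periodic hU hLU hDU hy] at h2
    refine ⟨?_, Polynomial.C (x (γ s₀)) * ξ, ?_, ?_⟩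
    · filter_upwards [self_mem_nhdsWithin] with v hv
      exact integrableOn_kernel hC (hx.continuousOn.mono hLU) _ _ hv
    · rw [← smul_eq_C_mul]
      exact Submodule.smul_mem _ _ hξ
    · have h3 := (h1.const_mul (x (γ s₀))).add h2
      rw [hxt, mul_comm _ (x (γ s₀)), ← add_zero (x (γ s₀) * _)]
      refine h3.congr' ?_
      filter_upwards [self_mem_nhdsWithin, hi] with v hv hiv
      have e : ∫ s in cutParam γ (γ s₀) v, kernel γ x (0 + 1) (γ s₀) s =
          ∫ s in cutParam γ (γ s₀) v, (x (γ s₀) * kernel γ (fun _ => 1) 1 (γ s₀) s +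
            dslope x (γ s₀) (γ s) * deriv γ s) := by
        refine setIntegral_congr_fun (measurableSet_cutParam hC.continuous _ _) fun s hs => ?_
        have h0 := sub_ne_zero_of_mem_cutParam hv hs
        have h4 := sub_smul_dslope x (γ s₀) (γ s)
        rw [smul_eq_mul] at h4
        simp only [kernel, zero_add, pow_one]
        field_simp
        linear_combination -(deriv γ s) * h4
      rw [e, integral_add (hiv.const_mul _), integral_const_mul, eval_mul, eval_C]
      · ring
      · exact (hyc.integrableOn_Icc (a := 0) (b := 1)).mono_set
          fun s hs => Ico_subset_Icc_self hs.1
  | succ m ih =>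
    intro x q hp hx hq
    have hC := hγ.contDiff_one (by omega)
    have hy : DifferentiableOn ℂ (dslope x (γ s₀)) U :=
      (Complex.differentiableOn_dslope (hU.mem_nhds (hLU ⟨s₀, rfl⟩))).2 hx
    obtain ⟨hi1, ξ, hξ, h1⟩ := hγ.hasHypersingularIntegral_one_succ (by omega : 1 ≤ m + 1) hp s₀
    obtain ⟨hi2, ζ, hζ, h2⟩ := ih (by omega) hy hq.has_fpower_series_dslope_fslope
    rw [FormalMultilinearSeries.coeff_fslope] at h2
    simp only [Nat.add_sub_cancel] at hξ hζ h1 h2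
    -- The factor `X` rewrites `ζ(v) / v^m` over the denominator `v^(m+1)`; the degree bound rises
    -- by one as well.
    refine ⟨?_, Polynomial.C (x (γ s₀)) * ξ + X * ζ, ?_, ?_⟩
    · filter_upwards [self_mem_nhdsWithin] with v hv
      exact integrableOn_kernel hC (hx.continuousOn.mono hLU) _ _ hv
    · rw [Nat.add_sub_cancel]
      refine Submodule.add_mem _ ?_ ?_
      · rw [← smul_eq_C_mul]
        exact Submodule.smul_mem _ _ hξ
      · rw [mem_degreeLT] at hζ ⊢
        rcases eq_or_ne ζ 0 with rfl | hζ0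
        · simp
        · rw [degree_mul, degree_X, degree_eq_natDegree hζ0] at *
          have : ζ.natDegree < m := by exact_mod_cast hζ
          have : 1 + ζ.natDegree < m + 1 := by omega
          exact_mod_cast this
    · have h3 := (h1.const_mul (x (γ s₀))).add h2
      rw [mul_zero, zero_add] at h3
      refine h3.congr' ?_
      filter_upwards [self_mem_nhdsWithin, hi1, hi2] with v hv hiv1 hiv2
      have e : ∫ s in cutParam γ (γ s₀) v, kernel γ x (m + 1 + 1) (γ s₀) s =
          ∫ s in cutParam γ (γ s₀) v, (x (γ s₀) * kernel γ (fun _ => 1) (m + 1 + 1) (γ s₀) s +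
            kernel γ (dslope x (γ s₀)) (m + 1) (γ s₀) s) := by
        refine setIntegral_congr_fun (measurableSet_cutParam hC.continuous _ _) fun s hs => ?_
        have h0 := sub_ne_zero_of_mem_cutParam hv hs
        have h4 := sub_smul_dslope x (γ s₀) (γ s)
        rw [smul_eq_mul] at h4
        simp only [kernel, pow_succ]
        field_simp
        linear_combination -(deriv γ s) * h4
      have hv' : (v : ℂ) ≠ 0 := by exact_mod_cast (ne_of_gt hv)
      rw [e, integral_add (hiv1.const_mul _) hiv2, integral_const_mul, eval_add, eval_mul, eval_C,
        eval_mul, eval_X, Nat.add_sub_cancel, pow_succ]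
      field_simp
      ring

end Hypersingular

/-! ### Equivalence of the two equations. -/

open Hypersingular in
theorem mainTheorem3 (p : ℕ) (hp : 1 ≤ p)
    (γ : ℝ → ℂ) (hγ : Hypersingular.IsSmoothContour p γ)
    (G : Set ℂ) (hG : IsConnected G)
    (hLG : Set.range γ ⊆ G) (hDG : Hypersingular.innerDomain γ ⊆ G)
    (a : ℕ → ℂ → ℂ) (f x : ℂ → ℂ) (hx : AnalyticOnNhd ℂ x G) :
    (Hypersingular.SolvesComposite γ p a f x ↔
      Hypersingular.SolvesODE (Set.range γ) p a f x) ∧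
    ((∀ k ≤ p, AnalyticOnNhd ℂ (a k) G) → AnalyticOnNhd ℂ f G →
      (Hypersingular.SolvesComposite γ p a f x ↔ Hypersingular.SolvesODE G p a f x)) := by
  have hval : ∀ t ∈ range γ, ∀ k ∈ Finset.Icc 1 p, HasHypersingularIntegral γ x k t
      (Real.pi * Complex.I * (iteratedDeriv (k - 1) x t / Nat.factorial (k - 1))) := by
    rintro _ ⟨s₀, rfl⟩ k hk
    rw [Finset.mem_Icc] at hk
    obtain ⟨m, rfl⟩ : ∃ m, k = m + 1 := ⟨k - 1, by omega⟩
    -- The set of points of analyticity of `x` is open and contains `G`, which itself need not be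
    -- open.
    have := hγ.hasHypersingularIntegral (U := {z | AnalyticAt ℂ x z}) (isOpen_analyticAt ℂ x)
      (fun z hz => hx z (hLG hz)) (fun z hz => hx z (hDG hz)) s₀ hk.2
      (fun z hz => AnalyticAt.differentiableAt hz |>.differentiableWithinAt)
      (hx _ (hLG ⟨s₀, rfl⟩)).hasFPowerSeriesAt
    rwa [FormalMultilinearSeries.coeff_ofScalars] at this
  have hpi : (Real.pi : ℂ) * Complex.I ≠ 0 :=
    mul_ne_zero (by exact_mod_cast Real.pi_ne_zero) Complex.I_ne_zero
  have hterm : ∀ t k, a k t / ((Real.pi : ℂ) * Complex.I) *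
      (Real.pi * Complex.I * (iteratedDeriv (k - 1) x t / Nat.factorial (k - 1))) =
      a k t / (Nat.factorial (k - 1) : ℂ) * iteratedDeriv (k - 1) x t := by
    intro t k
    rw [← mul_assoc, div_mul_cancel₀ _ hpi]
    ring
  have hmain : SolvesComposite γ p a f x ↔ SolvesODE (range γ) p a f x := by
    refine forall₂_congr fun t ht => ⟨?_, fun h => ?_⟩
    · rintro ⟨I, hI, h⟩
      rw [← h]
      congr 1
      refine Finset.sum_congr rfl fun k hk => ?_
      rw [(hI k hk).unique (hval t ht k hk), hterm]
    · refine ⟨_, hval t ht, ?_⟩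
      rw [← h]
      congr 1
      exact Finset.sum_congr rfl fun k _ => hterm t k
  refine ⟨hmain, fun ha hf => hmain.trans ⟨fun h => ?_, fun h t ht => h t (hLG ht)⟩⟩
  have hana : AnalyticOnNhd ℂ (fun t => ∑ k ∈ Finset.Icc 1 p,
      a k t / (Nat.factorial (k - 1) : ℂ) * iteratedDeriv (k - 1) x t + a 0 t * x t) G := by
    intro t ht
    refine AnalyticAt.add (Finset.analyticAt_fun_sum _ fun k hk => ?_)
      ((ha 0 (Nat.zero_le _) t ht).mul (hx t ht))
    refine ((ha k (Finset.mem_Icc.1 hk).2 t ht).div analyticAt_const ?_).mul ?_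
    · exact_mod_cast Nat.factorial_ne_zero _
    · rw [iteratedDeriv_eq_iterate]
      exact (hx t ht).iterated_deriv _
  refine hana.eqOn_of_preconnected_of_frequently_eq hf hG.isPreconnected (hLG ⟨0, rfl⟩) ?_
  -- Since the tangent is nonzero, `γ s ≠ γ 0` for small `s ≠ 0`, so `γ 0` is an accumulation point
  -- of the contour, where the equation holds.
  have hd : HasDerivAt γ (deriv γ 0) 0 :=
    ((hγ.contDiff_one hp).differentiable one_ne_zero 0).hasDerivAt
  exact (hd.tendsto_nhdsNE (hγ.deriv_ne_zero 0)).frequently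
    (Eventually.of_forall fun s => h _ ⟨s, rfl⟩).frequently
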